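/- Let $(M^n,\bar g)$ be a smooth Riemannian manifold with Levi-Civita connection $\bar\nabla$, and let its tangent bundle $TM^n$ carry the Sasaki metric $$g_s(\tilde X,\tilde Y)=\bar g(\pi_*\tilde X,\pi_*\tilde Y)+\bar g(K\tilde X,K\tilde Y),$$ where $\pi:TM^n\to M^n$ is the projection and $K:TTM^n\to TM^n$ is the connection map of $\bar\nabla$: in the coordinates $(x^a,\xi^a)$ of $TM^n$ induced by local coordinates of $M^n$, $(K\tilde X)^a=\tilde X^{n+a}+\bar\Gamma^a_{bc}\,\xi^b\tilde X^c$. Let $F^l$ be an immersed smooth submanifold of $M^n$ and let $\xi$ be a smooth vector field on $M^n$ along $F^l$ (that is, $\xi_p\in T_pM^n$ for $p\in F^l$; $\xi$ need not be tangent or normal to $F^l$) of constant length $|\xi|_{\bar g}$ along $F^l$. Then $\xi(F^l)$ is a totally geodesic submanifold of $(TM^n,g_s)$ if and only if $F^l$ is totally geodesic in $(M^n,\bar g)$ and $\xi$ is parallel along $F^l$, i.e. $\bar\nabla_X\xi=0$ for every vector $X$ tangent to $F^l$. Here a submanifold $N$ of a Riemannian manifold with metric $h$ and Levi-Civita connection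 $\nabla$ is totally geodesic if $h(\nabla_XY,\nu)=0$ for all vector fields $X,Y$ tangent to $N$ and all $\nu$ normal to $N$. -/

import Mathlib

open scoped Manifold ContDiff Topology

noncomputable section

section Geometry

variable {E : Type*} [NormedAddCommGroup E] [NormedSpace ℝ E]
  {H : Type*} [TopologicalSpace H] (I : ModelWithCorners ℝ E H)

/-- A field of bilinear forms on the tangent spaces of `M` (a metric, when it is symmetric,
positive definite and smooth). -/
abbrev MetricField (M : Type*) [TopologicalSpace M] [ChartedSpace H M] : Type _ :=
  ∀ x : M, TangentSpace I x →L[ℝ] TangentSpace I x →L[ℝ] ℝ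

variable {M : Type*} [TopologicalSpace M] [ChartedSpace H M]

/-- The coefficients of the metric `g` in the chart `φ` at `x₀`: for `y` in the target of the chart,
`gramInChart I g x₀ y u v = g (dφ⁻¹ u, dφ⁻¹ v)` at the point `φ⁻¹ y`; with `u = e_a`, `v = e_b`
this is `g_{ab}(y)`. -/
def gramInChart (g : MetricField I M) (x₀ : M) (y : E) : E →L[ℝ] E →L[ℝ] ℝ :=
  let gy : E →L[ℝ] E →L[ℝ] ℝ := g ((extChartAt I x₀).symm y)
  let dφinv : E →L[ℝ] E := mfderiv 𝓘(ℝ, E) I (extChartAt I x₀).symm y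
  gy.bilinearComp dφinv dφinv

/-- The Christoffel symbols of the Levi-Civita connection of `g` in the chart at `x₀`, at the
point `y` of the chart: `christoffel I g x₀ y u v` has the components `Γ^a_{bc} u^b v^c` with
`Γ^a_{bc} = ½ g^{ad} (∂_b g_{cd} + ∂_c g_{bd} - ∂_d g_{bc})`. The inverse `(g^{ad})` of the
coefficient matrix is the inverse of the map `E → E*` defined by the metric. -/
def christoffel (g : MetricField I M) (x₀ : M) (y u : E) : E →L[ℝ] E :=
  let dg : E →L[ℝ] E →L[ℝ] E →L[ℝ] ℝ := fderiv ℝ (gramInChart I g x₀) y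
  let ginv : (E →L[ℝ] ℝ) →L[ℝ] E := (gramInChart I g x₀ y).inverse
  (1 / 2 : ℝ) • (ginv ∘L dg u + ginv ∘L dg.flip u - ginv ∘L (dg.flip u).flip)

section Along

variable {E' : Type*} [NormedAddCommGroup E'] [NormedSpace ℝ E']
  {H' : Type*} [TopologicalSpace H'] (I' : ModelWithCorners ℝ E' H')
  {F : Type*} [TopologicalSpace F] [ChartedSpace H' F]

/-- The covariant derivative `∇_u V` at `p`, for the Levi-Civita connection of the metric `g` on
`M`, of a vector field `V` along a map `f : F → M` in the direction `u ∈ T_p F`: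
`(∇_u V)^a = u(V^a) + Γ^a_{bc} (df u)^b V^c` in the chart of `M` at `f p` (the chart which also
identifies the tangent space at `f p` with `E`). -/
def covDerivAlong (g : MetricField I M) (f : F → M) (V : ∀ q : F, TangentSpace I (f q))
    (p : F) (u : TangentSpace I' p) : TangentSpace I (f p) :=
  let Vcoord : F → E := fun q ↦ mfderiv I 𝓘(ℝ, E) (extChartAt I (f p)) (f q) (V q)
  let uV : E := mfderiv I' 𝓘(ℝ, E) Vcoord p u
  let dfu : E := mfderiv I' I f p u
  let Vp : E := V p
  (uV + christoffel I g (f p) (extChartAt I (f p) (f p)) dfu Vp : E)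

/-- `V` is parallel along `f`: `∇_u V = 0` for all tangent vectors `u` of `F`. -/
def IsParallelAlong (g : MetricField I M) (f : F → M) (V : ∀ q : F, TangentSpace I (f q)) : Prop :=
  ∀ (p : F) (u : TangentSpace I' p), covDerivAlong I I' g f V p u = 0

/-- The (immersed) submanifold `f : F → M` is totally geodesic with respect to the metric `g`:
`g (∇_u Y, ν) = 0` for all tangent vectors `u`, all tangent vector fields `Y` of the submanifold
that are smooth near the foot point of `u`, and all normal vectors `ν`. -/
def IsTotallyGeodesic [IsManifold I' 1 F] (g : MetricField I M) (f : F → M) : Prop :=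
  ∀ (p : F) (u : TangentSpace I' p) (Y : ∀ q : F, TangentSpace I' q),
    ContMDiffAt I' I'.tangent ∞ (fun q ↦ (⟨q, Y q⟩ : TangentBundle I' F)) p →
    ∀ ν : TangentSpace I (f p),
      (∀ w : TangentSpace I' p, g (f p) (mfderiv I' I f p w) ν = 0) →
      g (f p) (covDerivAlong I I' g f (fun q ↦ mfderiv I' I f q (Y q)) p u) ν = 0

end Along

variable [IsManifold I 1 M]

/-- The connection map `K : T_z TM → T_{π z} M`. If `(x, ξ)` are the coordinates on `TM` induced by
the chart at `π z` and `X` has the components `(X^a, X^{n+a})` in them, then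
`(K X)^a = X^{n+a} + Γ^a_{bc} ξ^b X^c`. -/
def connectionMap (g : MetricField I M) (z : TangentBundle I M) :
    TangentSpace I.tangent z →L[ℝ] TangentSpace I z.proj :=
  let ξ : E := z.snd
  let coord : E × E →L[ℝ] E × E := mfderiv I.tangent 𝓘(ℝ, E × E) (extChartAt I.tangent z) z
  let K : E × E →L[ℝ] E :=
    ContinuousLinearMap.snd ℝ E E ∘L coord +
      christoffel I g z.proj (extChartAt I z.proj z.proj) ξ ∘L
        ContinuousLinearMap.fst ℝ E E ∘L coord
  K

/-- The Sasaki metric on the tangent bundle: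
`g_s (X, Y) = g (π_* X, π_* Y) + g (K X, K Y)`. -/
def sasakiMetric (g : MetricField I M) : MetricField I.tangent (TangentBundle I M) := fun z ↦
  let gx : E →L[ℝ] E →L[ℝ] ℝ := g z.proj
  let dπ : E × E →L[ℝ] E := mfderiv I.tangent I (Bundle.TotalSpace.proj : TangentBundle I M → M) z
  let K : E × E →L[ℝ] E := connectionMap I g z
  gx.bilinearComp dπ dπ + gx.bilinearComp K K

end Geometry

end

/-! In coordinates, a map `f` into a space with metric `h` has on normal vectors ν the second
fundamental form h(D²f(u,w) + Γ(df u, df w), ν), and total geodesy is its vanishing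
(`isTotallyGeodesic_iff`). For the Sasaki metric the Koszul formula expresses this form directly
(`secondForm_sasakiModel`), so neither an explicit Sasaki connection nor the curvature is needed.

The vertical part of the velocity ξ_*u is ∇_uξ (`covDerivAlong_eq`). Constant length gives g(∇_uξ,
ξ) = 0 (`metric_connectionModel_eq_zero`), so the vertical lift of ξ is normal to ξ(F).
Differentiating that identity once more shows that the second form at (u,u), tested on this lift, is
-|∇_uξ|² (`secondForm_sasakiModel_vertical`). Hence total geodesy forces ξ to be parallel.

When ξ is parallel, the tangent vectors of ξ(F) are horizontal. Both the normality of N and the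
second form tested on N then depend only on π_*N, and they coincide with those of F
(`secondForm_sasakiModel_of_parallel`). This settles the converse and the rest of the direct
implication.

What remains is to pass to charts. The map K is defined at each point through the chart at that
point, whereas differentiating the Sasaki metric requires one fixed chart for all nearby points. The
transformation law of the Christoffel symbols (`christoffelMap_pullback`) bridges this, through
`chartDeriv_connectionMap` and `gramInChart_sasakiMetric`. -/

noncomputable section

set_option maxSynthPendingDepth 3

/-! ### Christoffel symbols of a metric on a vector space -/

section VectorSpace

variable {E : Type*} [NormedAddCommGroup E] [NormedSpace ℝ E]
  {E' : Type*} [NormedAddCommGroup E'] [NormedSpace ℝ E']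

/-- A positive definite bilinear form on a finite-dimensional space is nondegenerate. -/
theorem isInvertible_of_pos [FiniteDimensional ℝ E] (B : E →L[ℝ] E →L[ℝ] ℝ)
    (hB : ∀ v, v ≠ 0 → 0 < B v v) : B.IsInvertible := by
  have hinj : Function.Injective B := by
    rw [injective_iff_map_eq_zero]
    intro v hv
    by_contra hne
    simpa [hv] using hB v hne
  have hdim : Module.finrank ℝ E = Module.finrank ℝ (E →L[ℝ] ℝ) := by
    rw [← (LinearMap.toContinuousLinearMap (𝕜 := ℝ) (E := E) (F' := ℝ)).finrank_eq]
    exact (Subspace.dual_finrank_eq (K := ℝ) (V := E)).symm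
  let e := (LinearMap.linearEquivOfInjective (B : E →ₗ[ℝ] E →L[ℝ] ℝ) hinj
    hdim).toContinuousLinearEquiv
  exact ⟨e, by ext; rfl⟩

theorem apply_inverse_apply {B : E →L[ℝ] E →L[ℝ] ℝ} (hB : B.IsInvertible) (φ : E →L[ℝ] ℝ) :
    B (B.inverse φ) = φ := by
  obtain ⟨e, rfl⟩ := hB
  simp

/-- The Christoffel symbols of a metric `h` on a vector space, as a bilinear map. -/
def christoffelMap (h : E → E →L[ℝ] E →L[ℝ] ℝ) (y : E) : E →L[ℝ] E →L[ℝ] E :=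
  let dg : E →L[ℝ] E →L[ℝ] E →L[ℝ] ℝ := fderiv ℝ h y
  let c := ContinuousLinearMap.compL ℝ E (E →L[ℝ] ℝ) E (h y).inverse
  (1 / 2 : ℝ) • (c ∘L dg + c ∘L dg.flip -
    c ∘L ((ContinuousLinearMap.flipₗᵢ ℝ E E ℝ : _ →L[ℝ] _) ∘L dg.flip))

theorem christoffelMap_apply (h : E → E →L[ℝ] E →L[ℝ] ℝ) (y u v : E) :
    christoffelMap h y u v = (1 / 2 : ℝ) • ((h y).inverse (fderiv ℝ h y u v) +
      (h y).inverse (fderiv ℝ h y v u) - (h y).inverse (((fderiv ℝ h y).flip u).flip v)) := by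
  rfl

/-- The Koszul formula. -/
theorem metric_christoffelMap {h : E → E →L[ℝ] E →L[ℝ] ℝ} {y : E} (hy : (h y).IsInvertible)
    (u v w : E) : h y (christoffelMap h y u v) w =
      (1 / 2) * (fderiv ℝ h y u v w + fderiv ℝ h y v u w - fderiv ℝ h y w u v) := by
  simp only [christoffelMap_apply, map_smul, map_add, map_sub, apply_inverse_apply hy]
  simp

theorem fderiv_apply_apply {h : E' → E →L[ℝ] E →L[ℝ] ℝ} {y : E'} (hd : DifferentiableAt ℝ h y)
    (u : E') (v w : E) : fderiv ℝ h y u v w = fderiv ℝ (fun x ↦ h x v w) y u := by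
  have := ((hd.hasFDerivAt.clm_apply (hasFDerivAt_const v y)).clm_apply
    (hasFDerivAt_const w y)).fderiv
  rw [this]; simp

theorem fderiv_metric_symm {h : E' → E →L[ℝ] E →L[ℝ] ℝ} {y : E'} (hd : DifferentiableAt ℝ h y)
    (hs : ∀ x v w, h x v w = h x w v) (u : E') (v w : E) :
    fderiv ℝ h y u v w = fderiv ℝ h y u w v := by
  simp_rw [fderiv_apply_apply hd, hs _ v w]

theorem christoffelMap_symm {h : E → E →L[ℝ] E →L[ℝ] ℝ} {y : E} (hd : DifferentiableAt ℝ h y)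
    (hs : ∀ x v w, h x v w = h x w v) (u v : E) :
    christoffelMap h y u v = christoffelMap h y v u := by
  have : ((fderiv ℝ h y).flip u).flip v = ((fderiv ℝ h y).flip v).flip u := by
    ext w
    exact fderiv_metric_symm hd hs w u v
  rw [christoffelMap_apply, christoffelMap_apply, this, add_comm ((h y).inverse _)]

/-- The connection given by the Christoffel symbols is compatible with the metric. -/
theorem fderiv_metric_eq {h : E → E →L[ℝ] E →L[ℝ] ℝ} {y : E} (hd : DifferentiableAt ℝ h y)
    (hs : ∀ x v w, h x v w = h x w v) (hy : (h y).IsInvertible) (u v w : E) :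
    fderiv ℝ h y u v w = h y (christoffelMap h y u v) w + h y v (christoffelMap h y u w) := by
  rw [hs y v, metric_christoffelMap hy, metric_christoffelMap hy, fderiv_metric_symm hd hs u w v,
    fderiv_metric_symm hd hs w u v, fderiv_metric_symm hd hs v u w]
  ring

/-- The Sasaki metric contains the Christoffel symbols, so its own Koszul formula differentiates
them. This costs two derivatives of the metric, and inversion is smooth at an invertible map. -/
theorem differentiableAt_christoffelMap [CompleteSpace E] {h : E → E →L[ℝ] E →L[ℝ] ℝ} {y : E}
    (hd : ContDiffAt ℝ 2 h y) (hy : (h y).IsInvertible) :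
    DifferentiableAt ℝ (christoffelMap h) y := by
  have h1 : DifferentiableAt ℝ (fderiv ℝ h) y :=
    (hd.fderiv_right (m := 1) (by norm_num)).differentiableAt (by norm_num)
  have h2 : DifferentiableAt ℝ (fun x ↦ (h x).inverse) y := by
    obtain ⟨e, he⟩ := hy
    have : ContDiffAt ℝ 2 (ContinuousLinearMap.inverse : (E →L[ℝ] E →L[ℝ] ℝ) → _) (h y) := by
      rw [← he]; exact contDiffAt_map_inverse e
    exact (this.comp y hd).differentiableAt (by norm_num)
  have h3 : DifferentiableAt ℝ
      (fun x ↦ ContinuousLinearMap.compL ℝ E (E →L[ℝ] ℝ) E (h x).inverse) y :=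
    (differentiableAt_const (c := ContinuousLinearMap.compL ℝ E (E →L[ℝ] ℝ) E)).clm_apply h2
  have h4 : DifferentiableAt ℝ (fun x ↦ (fderiv ℝ h x).flip) y :=
    (ContinuousLinearMap.flipₗᵢ ℝ E E
      (E →L[ℝ] ℝ)).toContinuousLinearEquiv.differentiableAt.comp y h1
  unfold christoffelMap
  exact (((h3.clm_comp h1).add (h3.clm_comp h4)).sub
    (h3.clm_comp ((differentiableAt_const _).clm_comp h4))).const_smul (1 / 2 : ℝ)

/-- The Christoffel symbols under a change of coordinates `σ`. -/
theorem christoffelMap_pullback {h k : E → E →L[ℝ] E →L[ℝ] ℝ} {σ : E → E} {y : E}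
    (hσ : ContDiffAt ℝ 2 σ y) (hpull : ∀ᶠ x in 𝓝 y, ∀ v w, h x v w =
      k (σ x) (fderiv ℝ σ x v) (fderiv ℝ σ x w))
    (hh : DifferentiableAt ℝ h y) (hk : DifferentiableAt ℝ k (σ y))
    (ks : ∀ x v w, k x v w = k x w v)
    (hi : (h y).IsInvertible) (ki : ∀ v, v ≠ 0 → 0 < k (σ y) v v)
    (kI : (k (σ y)).IsInvertible)
    (hsurj : Function.Surjective (fderiv ℝ σ y)) (a b : E) :
    fderiv ℝ σ y (christoffelMap h y a b) =
      fderiv ℝ (fderiv ℝ σ) y a b +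
        christoffelMap k (σ y) (fderiv ℝ σ y a) (fderiv ℝ σ y b) := by
  have hσ' : HasFDerivAt σ (fderiv ℝ σ y) y := (hσ.differentiableAt (by norm_num)).hasFDerivAt
  have hσ2 : HasFDerivAt (fderiv ℝ σ) (fderiv ℝ (fderiv ℝ σ) y) y :=
    ((hσ.fderiv_right (m := 1) (by norm_num)).differentiableAt (by norm_num)).hasFDerivAt
  have hsym : ∀ u v, fderiv ℝ (fderiv ℝ σ) y u v = fderiv ℝ (fderiv ℝ σ) y v u :=
    fun u v ↦ (hσ.isSymmSndFDerivAt (by simp)) u v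
  -- The derivative of the pullback relation: one term from the metric `k`, and two from the second
  -- derivative of `σ`.
  have key : ∀ u v w, fderiv ℝ h y u v w =
      fderiv ℝ k (σ y) (fderiv ℝ σ y u) (fderiv ℝ σ y v) (fderiv ℝ σ y w) +
      k (σ y) (fderiv ℝ (fderiv ℝ σ) y u v) (fderiv ℝ σ y w) +
      k (σ y) (fderiv ℝ (fderiv ℝ σ) y u w) (fderiv ℝ σ y v) := by
    intro u v w
    have e : (fun x ↦ h x v w) =ᶠ[𝓝 y]
        fun x ↦ k (σ x) (fderiv ℝ σ x v) (fderiv ℝ σ x w) := by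
      filter_upwards [hpull] with x hx using hx v w
    rw [fderiv_apply_apply hh, e.fderiv_eq]
    have hc : HasFDerivAt (fun x ↦ k (σ x)) _ y := hk.hasFDerivAt.comp y hσ'
    have hv (v : E) : HasFDerivAt (fun x ↦ fderiv ℝ σ x v) _ y :=
      hσ2.clm_apply (hasFDerivAt_const v y)
    have := ((hc.clm_apply (hv v)).clm_apply (hv w)).fderiv
    rw [this, ks _ (fderiv ℝ (fderiv ℝ σ) y u w)]
    simp
    ring
  rw [← sub_eq_zero]
  by_contra hne
  -- The difference of the two sides is shown to have square norm zero for `k`. Writing one copy of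
  -- it as the image of `c` allows the Koszul formulas of `h` and `k` to be compared.
  obtain ⟨c, hc⟩ := hsurj (fderiv ℝ σ y (christoffelMap h y a b) -
      (fderiv ℝ (fderiv ℝ σ) y a b +
        christoffelMap k (σ y) (fderiv ℝ σ y a) (fderiv ℝ σ y b)))
  have hp := ki _ hne
  nth_rw 2 [← hc] at hp
  have e1 := hpull.self_of_nhds (christoffelMap h y a b) c
  rw [metric_christoffelMap hi, key, key, key] at e1
  simp only [map_sub, map_add, sub_apply, add_apply,
    metric_christoffelMap kI, ← e1] at hp
  -- By symmetry of the second derivative, four of the six Hessian terms in the Koszul sum cancel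
  -- and the other two are equal.
  rw [hsym b a, hsym c a, hsym c b] at hp
  linarith

end VectorSpace

/-! ### The Sasaki metric in coordinates and its second fundamental form -/

section SasakiModel

variable {E : Type*} [NormedAddCommGroup E] [NormedSpace ℝ E]
  {E' : Type*} [NormedAddCommGroup E'] [NormedSpace ℝ E']

/-- The connection map in the coordinates of the tangent bundle of a vector space. -/
def connectionModel (h : E → E →L[ℝ] E →L[ℝ] ℝ) (z : E × E) : E × E →L[ℝ] E :=
  ContinuousLinearMap.snd ℝ E E + christoffelMap h z.1 z.2 ∘L ContinuousLinearMap.fst ℝ E E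

/-- The Sasaki metric in the coordinates of the tangent bundle of a vector space. -/
def sasakiModel (h : E → E →L[ℝ] E →L[ℝ] ℝ) (z : E × E) : E × E →L[ℝ] E × E →L[ℝ] ℝ :=
  (h z.1).bilinearComp (ContinuousLinearMap.fst ℝ E E) (ContinuousLinearMap.fst ℝ E E) +
    (h z.1).bilinearComp (connectionModel h z) (connectionModel h z)

variable {h : E → E →L[ℝ] E →L[ℝ] ℝ}

theorem connectionModel_apply (z P : E × E) :
    connectionModel h z P = P.2 + christoffelMap h z.1 z.2 P.1 := rfl

theorem sasakiModel_apply (z P Q : E × E) : sasakiModel h z P Q =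
    h z.1 P.1 Q.1 + h z.1 (connectionModel h z P) (connectionModel h z Q) := rfl

theorem sasakiModel_pos {z : E × E} (hp : ∀ v, v ≠ 0 → 0 < h z.1 v v) {P : E × E} (hP : P ≠ 0) :
    0 < sasakiModel h z P P := by
  have hp' (v : E) : 0 ≤ h z.1 v v := by
    rcases eq_or_ne v 0 with rfl | hv
    · simp
    · exact (hp v hv).le
  rw [sasakiModel_apply]
  rcases eq_or_ne P.1 0 with h1 | h1
  · have h2 : P.2 ≠ 0 := fun h2 ↦ hP (Prod.ext h1 h2)
    have : connectionModel h z P ≠ 0 := by simpa [connectionModel_apply, h1] using h2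
    linarith [hp _ this, hp' P.1]
  · linarith [hp _ h1, hp' (connectionModel h z P)]

theorem hasFDerivAt_connectionModel {z : E × E}
    (hΓ : DifferentiableAt ℝ (christoffelMap h) z.1) :
    HasFDerivAt (connectionModel h) (fderiv ℝ (connectionModel h) z) z ∧
    ∀ Z P : E × E, fderiv ℝ (connectionModel h) z Z P =
      fderiv ℝ (christoffelMap h) z.1 Z.1 z.2 P.1 + christoffelMap h z.1 Z.2 P.1 := by
  have h1 : HasFDerivAt (fun x : E × E ↦ christoffelMap h x.1) _ z :=
    hΓ.hasFDerivAt.comp z hasFDerivAt_fst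
  have h2 := (hasFDerivAt_const (ContinuousLinearMap.snd ℝ E E) z).add
    ((h1.clm_apply hasFDerivAt_snd).clm_comp
      (hasFDerivAt_const (ContinuousLinearMap.fst ℝ E E) z))
  have h3 : HasFDerivAt (connectionModel h) _ z := h2
  refine ⟨h3.differentiableAt.hasFDerivAt, fun Z P ↦ ?_⟩
  rw [h3.fderiv]
  simp [add_comm]

theorem differentiableAt_sasakiModel {z : E × E} (hd : DifferentiableAt ℝ h z.1)
    (hΓ : DifferentiableAt ℝ (christoffelMap h) z.1) :
    DifferentiableAt ℝ (sasakiModel h) z := by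
  have h0 : DifferentiableAt ℝ (fun x : E × E ↦ h x.1) z := hd.comp z differentiableAt_fst
  have hk := (hasFDerivAt_connectionModel hΓ).1.differentiableAt
  have e : sasakiModel h = fun x ↦
      (ContinuousLinearMap.precomp ℝ (ContinuousLinearMap.fst ℝ E E)) ∘L
        (h x.1 ∘L ContinuousLinearMap.fst ℝ E E) +
      (ContinuousLinearMap.compL ℝ (E × E) E ℝ).flip (connectionModel h x) ∘L
        (h x.1 ∘L connectionModel h x) := by
    funext x; rfl
  rw [e]
  refine ((differentiableAt_const _).clm_comp (h0.clm_comp (differentiableAt_const _))).add ?_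
  exact ((differentiableAt_const _).clm_apply hk).clm_comp (h0.clm_comp hk)

theorem fderiv_sasakiModel {z : E × E} (hd : DifferentiableAt ℝ h z.1)
    (hΓ : DifferentiableAt ℝ (christoffelMap h) z.1) (Z P Q : E × E) :
    fderiv ℝ (sasakiModel h) z Z P Q = fderiv ℝ h z.1 Z.1 P.1 Q.1 +
      fderiv ℝ h z.1 Z.1 (connectionModel h z P) (connectionModel h z Q) +
      h z.1 (fderiv ℝ (connectionModel h) z Z P) (connectionModel h z Q) +
      h z.1 (connectionModel h z P) (fderiv ℝ (connectionModel h) z Z Q) := by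
  have h0 : HasFDerivAt (fun x : E × E ↦ h x.1) _ z := hd.hasFDerivAt.comp z hasFDerivAt_fst
  have hk := (hasFDerivAt_connectionModel hΓ).1
  have hkP (P : E × E) : HasFDerivAt (fun x ↦ connectionModel h x P) _ z :=
    hk.clm_apply (hasFDerivAt_const P z)
  have h1 := ((h0.clm_apply (hasFDerivAt_const P.1 z)).clm_apply
    (hasFDerivAt_const Q.1 z)).add ((h0.clm_apply (hkP P)).clm_apply (hkP Q))
  have h2 : HasFDerivAt (fun x ↦ sasakiModel h x P Q) _ z := h1
  rw [fderiv_apply_apply (differentiableAt_sasakiModel hd hΓ), h2.fderiv]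
  simp
  ring

/-- The covariant derivative along a map `f` of the image of the constant field `w` in the direction
`u`, as a functional through the metric; on normal vectors it is the second fundamental form. -/
def secondForm (h : E → E →L[ℝ] E →L[ℝ] ℝ) (f : E' → E) (x : E') (u w : E') : E →L[ℝ] ℝ :=
  h (f x) (fderiv ℝ (fderiv ℝ f) x u w +
    christoffelMap h (f x) (fderiv ℝ f x u) (fderiv ℝ f x w))

/-- The derivative of the vertical part of the tangent vectors of a map into the tangent bundle. -/
theorem fderiv_connectionModel_comp {f : E' → E × E} {x : E'} (hf : ContDiffAt ℝ 2 f x)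
    (hΓ : DifferentiableAt ℝ (christoffelMap h) (f x).1) (u w : E') :
    HasFDerivAt (fun y ↦ connectionModel h (f y) (fderiv ℝ f y w))
      (fderiv ℝ (fun y ↦ connectionModel h (f y) (fderiv ℝ f y w)) x) x ∧
    fderiv ℝ (fun y ↦ connectionModel h (f y) (fderiv ℝ f y w)) x u =
      fderiv ℝ (connectionModel h) (f x) (fderiv ℝ f x u) (fderiv ℝ f x w) +
        connectionModel h (f x) (fderiv ℝ (fderiv ℝ f) x u w) := by
  have h1 : HasFDerivAt f _ x := (hf.differentiableAt (by norm_num)).hasFDerivAt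
  have h2 : HasFDerivAt (fderiv ℝ f) _ x :=
    ((hf.fderiv_right (m := 1) (by norm_num)).differentiableAt (by norm_num)).hasFDerivAt
  have hk : HasFDerivAt (fun y ↦ connectionModel h (f y)) _ x :=
    (hasFDerivAt_connectionModel hΓ).1.comp x h1
  have h3 := hk.clm_apply (h2.clm_apply (hasFDerivAt_const w x))
  refine ⟨h3.differentiableAt.hasFDerivAt, ?_⟩
  rw [h3.fderiv]
  simp [add_comm]

variable [FiniteDimensional ℝ E]

/-- Lowering the index with the metric cancels the inverse in the Christoffel symbols, leaving first
derivatives of the Sasaki metric only. Positive definiteness serves solely to make that inverse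
genuine. -/
theorem secondForm_sasakiModel {f : E' → E × E} {x : E'}
    (hd : ContDiffAt ℝ 2 h (f x).1) (hp : ∀ v, v ≠ 0 → 0 < h (f x).1 v v)
    (u w : E') (N : E × E) :
    let κ := connectionModel h (f x)
    let A := fderiv ℝ (connectionModel h) (f x)
    let U := fderiv ℝ f x u
    let W := fderiv ℝ f x w
    let D := fderiv ℝ (fderiv ℝ f) x u w
    secondForm (sasakiModel h) f x u w N =
      h (f x).1 (D.1 + christoffelMap h (f x).1 U.1 W.1) N.1 + h (f x).1 (κ D) (κ N) +
      (1 / 2) * (fderiv ℝ h (f x).1 U.1 (κ W) (κ N) + fderiv ℝ h (f x).1 W.1 (κ U) (κ N) -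
        fderiv ℝ h (f x).1 N.1 (κ U) (κ W) +
        h (f x).1 (A U W) (κ N) + h (f x).1 (κ W) (A U N) +
        h (f x).1 (A W U) (κ N) + h (f x).1 (κ U) (A W N) -
        h (f x).1 (A N U) (κ W) - h (f x).1 (κ U) (A N W)) := by
  intro κ A U W D
  have hd' : DifferentiableAt ℝ h (f x).1 := hd.differentiableAt (by norm_num)
  have hΓ := differentiableAt_christoffelMap hd (isInvertible_of_pos _ hp)
  have hI : (sasakiModel h (f x)).IsInvertible :=
    isInvertible_of_pos _ fun P hP ↦ sasakiModel_pos hp hP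
  rw [secondForm, map_add, add_apply, metric_christoffelMap hI, fderiv_sasakiModel hd' hΓ,
    fderiv_sasakiModel hd' hΓ, fderiv_sasakiModel hd' hΓ, sasakiModel_apply, map_add, add_apply,
    metric_christoffelMap (isInvertible_of_pos _ hp)]
  ring

/-- Along a field with parallel velocity, the second fundamental form of the field with respect to
the Sasaki metric is horizontal. -/
theorem secondForm_sasakiModel_of_parallel {f : E' → E × E} {x : E'} (hf : ContDiffAt ℝ 2 f x)
    (hd : ContDiffAt ℝ 2 h (f x).1) (hp : ∀ v, v ≠ 0 → 0 < h (f x).1 v v)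
    (hpar : ∀ᶠ y in 𝓝 x, ∀ w, connectionModel h (f y) (fderiv ℝ f y w) = 0)
    (u w : E') (N : E × E) :
    secondForm (sasakiModel h) f x u w N = secondForm h (fun y ↦ (f y).1) x u w N.1 := by
  have hΓ := differentiableAt_christoffelMap hd (isInvertible_of_pos _ hp)
  have hz (w : E') : connectionModel h (f x) (fderiv ℝ f x w) = 0 := hpar.self_of_nhds w
  -- Parallelism holds in a neighbourhood, so the equation that the vertical part vanishes may be
  -- differentiated. The resulting relation cancels all vertical terms of the second form.
  have key (u w : E') : fderiv ℝ (connectionModel h) (f x) (fderiv ℝ f x u) (fderiv ℝ f x w) =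
      - connectionModel h (f x) (fderiv ℝ (fderiv ℝ f) x u w) := by
    have e : (fun y ↦ connectionModel h (f y) (fderiv ℝ f y w)) =ᶠ[𝓝 x] fun _ ↦ 0 := by
      filter_upwards [hpar] with y hy using hy w
    rw [eq_neg_iff_add_eq_zero, ← (fderiv_connectionModel_comp hf hΓ u w).2, e.fderiv_eq]
    simp
  have hsym : fderiv ℝ (fderiv ℝ f) x u w = fderiv ℝ (fderiv ℝ f) x w u :=
    (hf.isSymmSndFDerivAt (by simp)) u w
  have e1 : ∀ᶠ y in 𝓝 x, fderiv ℝ (fun y ↦ (f y).1) y =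
      ContinuousLinearMap.fst ℝ E E ∘L fderiv ℝ f y := by
    filter_upwards [hf.eventually (by simp)] with y hy
    exact (hy.differentiableAt (by norm_num)).hasFDerivAt.fst.fderiv
  have h2 : HasFDerivAt (fderiv ℝ f) _ x :=
    ((hf.fderiv_right (m := 1) (by norm_num)).differentiableAt (by norm_num)).hasFDerivAt
  have e2 : fderiv ℝ (fderiv ℝ (fun y ↦ (f y).1)) x u w = (fderiv ℝ (fderiv ℝ f) x u w).1 := by
    have e1' : fderiv ℝ (fun y ↦ (f y).1) =ᶠ[𝓝 x] fun y ↦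
      ContinuousLinearMap.fst ℝ E E ∘L fderiv ℝ f y := e1
    rw [e1'.fderiv_eq, ((hasFDerivAt_const _ x).clm_comp h2).fderiv]
    simp
  rw [secondForm_sasakiModel hd hp]
  simp only [hz, key]
  rw [secondForm, e2, e1.self_of_nhds, hsym]
  simp
  ring

/-- The covariant derivative of a field of constant length is orthogonal to the field. -/
theorem metric_connectionModel_eq_zero {f : E' → E × E} {x : E'} (hf : DifferentiableAt ℝ f x)
    (hd : DifferentiableAt ℝ h (f x).1) (hs : ∀ y v w, h y v w = h y w v)
    (hp : ∀ v, v ≠ 0 → 0 < h (f x).1 v v) {c : ℝ}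
    (hc : ∀ᶠ y in 𝓝 x, h (f y).1 (f y).2 (f y).2 = c) (w : E') :
    h (f x).1 (connectionModel h (f x) (fderiv ℝ f x w)) (f x).2 = 0 := by
  have hI := isInvertible_of_pos _ hp
  have h0 : HasFDerivAt (fun y ↦ h (f y).1) _ x := hd.hasFDerivAt.comp x hf.hasFDerivAt.fst
  have h1 := ((h0.clm_apply hf.hasFDerivAt.snd).clm_apply hf.hasFDerivAt.snd).fderiv
  have e : (fun y ↦ h (f y).1 (f y).2 (f y).2) =ᶠ[𝓝 x] fun _ ↦ c := hc
  rw [e.fderiv_eq] at h1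
  have h2 := congrArg (fun L ↦ L w) h1
  simp [fderiv_metric_eq hd hs hI] at h2
  rw [hs _ (f x).2, hs _ (f x).2] at h2
  rw [connectionModel_apply, christoffelMap_symm hd hs, map_add, add_apply]
  linarith

/-- The test vector is the vertical lift of the field. The Koszul expression is the derivative of
g(∇_uξ, ξ) in the direction `u`, which is zero for constant length, minus |∇_uξ|². -/
theorem secondForm_sasakiModel_vertical {f : E' → E × E} {x : E'} (hf : ContDiffAt ℝ 2 f x)
    (hd : ContDiffAt ℝ 2 h (f x).1) (hs : ∀ y v w, h y v w = h y w v)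
    (hp : ∀ᶠ y in 𝓝 (f x).1, ∀ v, v ≠ 0 → 0 < h y v v) {c : ℝ}
    (hc : ∀ᶠ y in 𝓝 x, h (f y).1 (f y).2 (f y).2 = c) (u : E') :
    secondForm (sasakiModel h) f x u u (0, (f x).2) =
      - h (f x).1 (connectionModel h (f x) (fderiv ℝ f x u))
        (connectionModel h (f x) (fderiv ℝ f x u)) := by
  have hp0 := hp.self_of_nhds
  have hd0 : DifferentiableAt ℝ h (f x).1 := hd.differentiableAt (by norm_num)
  have hΓ := differentiableAt_christoffelMap hd (isInvertible_of_pos _ hp0)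
  have hf1 : HasFDerivAt f _ x := (hf.differentiableAt (by norm_num)).hasFDerivAt
  have hcont : ContinuousAt (fun y ↦ (f y).1) x := hf1.fst.continuousAt
  have hev : (fun y ↦ h (f y).1 (connectionModel h (f y) (fderiv ℝ f y u)) (f y).2)
      =ᶠ[𝓝 x] fun _ ↦ 0 := by
    filter_upwards [hf.eventually (by simp), hcont.eventually (hd.eventually (by simp)),
      hcont.eventually hp, hc.eventually_nhds] with y h1 h2 h3 h4
    exact metric_connectionModel_eq_zero (h1.differentiableAt (by norm_num))
      (h2.differentiableAt (by norm_num)) hs h3 h4 u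
  have h0 : HasFDerivAt (fun y ↦ h (f y).1) _ x := hd0.hasFDerivAt.comp x hf1.fst
  have hder := ((h0.clm_apply (fderiv_connectionModel_comp hf hΓ u u).1).clm_apply
    hf1.snd).fderiv
  rw [hev.fderiv_eq] at hder
  have h2 := congrArg (fun L ↦ L u) hder
  simp [(fderiv_connectionModel_comp hf hΓ u u).2] at h2
  have hA (Z P : E × E) := (hasFDerivAt_connectionModel (z := f x) hΓ).2 Z P
  -- The derivative of the connection map sees only the base component of its last argument, and a
  -- vertical vector has none.
  have e1 (Z : E × E) : fderiv ℝ (connectionModel h) (f x) Z (0, (f x).2) = 0 := by simp [hA]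
  have e2 (P : E × E) : fderiv ℝ (connectionModel h) (f x) (0, (f x).2) P =
      christoffelMap h (f x).1 (f x).2 P.1 := by simp [hA]
  have e3 : connectionModel h (f x) (0, (f x).2) = (f x).2 := by simp [connectionModel_apply]
  have e4 : christoffelMap h (f x).1 (f x).2 (fderiv ℝ f x u).1 =
      connectionModel h (f x) (fderiv ℝ f x u) - (fderiv ℝ f x u).2 := by
    simp [connectionModel_apply]
  rw [secondForm_sasakiModel hd hp0]
  simp only [e1, e2, e3, e4]
  simp
  rw [hs _ (connectionModel h (f x) (fderiv ℝ f x u)) (fderiv ℝ f x u).2] at h2 ⊢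
  linarith

end SasakiModel

/-! ### Charts, their differentials and the metric coefficients -/

section Charts

variable {E : Type*} [NormedAddCommGroup E] [NormedSpace ℝ E]
  {H : Type*} [TopologicalSpace H] (I : ModelWithCorners ℝ E H)
  {M : Type*} [TopologicalSpace M] [ChartedSpace H M]

/-- The differential of a chart, as an endomorphism of the model space. -/
def chartDeriv (x₀ x : M) : E →L[ℝ] E := mfderiv I 𝓘(ℝ, E) (extChartAt I x₀) x

/-- The differential of an inverse chart, as an endomorphism of the model space. -/
def chartSymmDeriv (x₀ : M) (y : E) : E →L[ℝ] E := mfderiv 𝓘(ℝ, E) I (extChartAt I x₀).symm y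

variable [I.Boundaryless]

section

variable [IsManifold I 1 M] {x₀ : M}

theorem chartDeriv_chartSymmDeriv {y : E} (hy : y ∈ (extChartAt I x₀).target) (v : E) :
    chartDeriv I x₀ ((extChartAt I x₀).symm y) (chartSymmDeriv I x₀ y v) = v := by
  have := mfderiv_extChartAt_comp_mfderivWithin_extChartAt_symm hy
  rw [I.range_eq_univ, mfderivWithin_univ] at this
  exact congrArg (fun L ↦ L v) this

theorem chartSymmDeriv_chartDeriv' {x : M} (hx : x ∈ (extChartAt I x₀).source) (v : E) :
    chartSymmDeriv I x₀ (extChartAt I x₀ x) (chartDeriv I x₀ x v) = v := by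
  have := mfderivWithin_extChartAt_symm_comp_mfderiv_extChartAt' hx
  rw [I.range_eq_univ, mfderivWithin_univ] at this
  exact congrArg (fun L ↦ L v) this

theorem chartDeriv_chartSymmDeriv' {x : M} (hx : x ∈ (extChartAt I x₀).source) (v : E) :
    chartDeriv I x₀ x (chartSymmDeriv I x₀ (extChartAt I x₀ x) v) = v := by
  have := chartDeriv_chartSymmDeriv I ((extChartAt I x₀).map_source hx) v
  rwa [(extChartAt I x₀).left_inv hx] at this

omit [I.Boundaryless] in
theorem chartDeriv_self (x : M) : chartDeriv I x x = ContinuousLinearMap.id ℝ E :=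
  mfderiv_extChartAt_self

theorem chartSymmDeriv_self (x : M) :
    chartSymmDeriv I x (extChartAt I x x) = ContinuousLinearMap.id ℝ E := by
  have := mfderivWithin_range_extChartAt_symm (I := I) (x := x)
  rw [I.range_eq_univ, mfderivWithin_univ] at this
  exact this

theorem mdifferentiableAt_extChartAt_symm {y : E} (hy : y ∈ (extChartAt I x₀).target) :
    MDifferentiableAt 𝓘(ℝ, E) I (extChartAt I x₀).symm y := by
  have := mdifferentiableWithinAt_extChartAt_symm hy
  rwa [I.range_eq_univ, mdifferentiableWithinAt_univ] at this

end

section Gram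

variable (g : MetricField I M) {x₀ : M}

omit [I.Boundaryless] in
theorem gramInChart_apply (y u v : E) : gramInChart I g x₀ y u v =
    (g ((extChartAt I x₀).symm y) : E →L[ℝ] E →L[ℝ] ℝ) (chartSymmDeriv I x₀ y u)
      (chartSymmDeriv I x₀ y v) := rfl

omit [I.Boundaryless] in
theorem gramInChart_symm (hs : ∀ (x : M) (v w : TangentSpace I x), g x v w = g x w v)
    (y u v : E) :
    gramInChart I g x₀ y u v = gramInChart I g x₀ y v u :=
  hs ((extChartAt I x₀).symm y) (chartSymmDeriv I x₀ y u) (chartSymmDeriv I x₀ y v)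

omit [I.Boundaryless] in
theorem christoffel_eq (y u : E) : christoffel I g x₀ y u =
    christoffelMap (gramInChart I g x₀) y u := by
  refine ContinuousLinearMap.ext fun v ↦ ?_
  rw [christoffelMap_apply]
  rfl

variable [IsManifold I 1 M]

theorem gramInChart_pos (hp : ∀ (x : M) (v : TangentSpace I x), v ≠ 0 → 0 < g x v v) {y : E}
    (hy : y ∈ (extChartAt I x₀).target) (v : E) (hv : v ≠ 0) : 0 < gramInChart I g x₀ y v v := by
  have h : chartSymmDeriv I x₀ y v ≠ 0 := fun h ↦ hv <| by
    rw [← chartDeriv_chartSymmDeriv I hy v, h, map_zero]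
  rw [gramInChart_apply]
  exact hp ((extChartAt I x₀).symm y) (chartSymmDeriv I x₀ y v) h

theorem gramInChart_chartDeriv {x : M} (hx : x ∈ (extChartAt I x₀).source) (u v : E) :
    gramInChart I g x₀ (extChartAt I x₀ x) (chartDeriv I x₀ x u) (chartDeriv I x₀ x v) =
      (g x : E →L[ℝ] E →L[ℝ] ℝ) u v := by
  rw [gramInChart_apply, chartSymmDeriv_chartDeriv' I hx, chartSymmDeriv_chartDeriv' I hx,
    (extChartAt I x₀).left_inv hx]

theorem gramInChart_self (x : M) : gramInChart I g x (extChartAt I x x) =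
    (g x : E →L[ℝ] E →L[ℝ] ℝ) := by
  refine ContinuousLinearMap.ext fun u ↦ ContinuousLinearMap.ext fun v ↦ ?_
  have := gramInChart_chartDeriv I g (mem_extChartAt_source (I := I) x) u v
  rwa [chartDeriv_self] at this

end Gram

omit [I.Boundaryless] in
theorem trivializationAt_snd [IsManifold I 1 M] {x₀ x : M} (hx : x ∈ (extChartAt I x₀).source)
    (v : TangentSpace I x) :
    (trivializationAt E (TangentSpace I) x₀ ⟨x, v⟩).2 = chartDeriv I x₀ x v := by
  rw [extChartAt_source] at hx
  have h1 := TangentBundle.continuousLinearMapAt_trivializationAt (I := I) hx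
  have h2 := congrFun ((trivializationAt E (TangentSpace I) x₀).coe_linearMapAt_of_mem (R := ℝ)
    (b := x) hx) v
  exact h2.symm.trans (congrArg (fun L ↦ L v) h1)

/-- The coordinate fields of the chart are smooth sections, being constant in the trivialization at
`x₀`; evaluating the smooth metric on two of them gives a smooth coefficient. -/
theorem contDiffAt_gramInChart [FiniteDimensional ℝ E] [IsManifold I ∞ M]
    (g : Bundle.ContMDiffRiemannianMetric I ∞ E (fun x : M ↦ TangentSpace I x)) {x₀ : M} {y : E}
    (hy : y ∈ (extChartAt I x₀).target) : ContDiffAt ℝ ∞ (gramInChart I g.inner x₀) y := by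
  have hopen := isOpen_extChartAt_target (I := I) x₀
  suffices h : ContDiffOn ℝ ∞ (gramInChart I g.inner x₀) (extChartAt I x₀).target from
    h.contDiffAt (hopen.mem_nhds hy)
  rw [contDiffOn_clm_apply]
  intro u
  rw [contDiffOn_clm_apply]
  intro v y hy
  have hsec (a : E) : ContMDiffAt 𝓘(ℝ, E) I.tangent ∞ (fun y ↦
      (⟨(extChartAt I x₀).symm y, chartSymmDeriv I x₀ y a⟩ : TangentBundle I M)) y := by
    have h1 := (contMDiffOn_extChartAt_symm (I := I) (n := ∞) x₀).contMDiffAt (hopen.mem_nhds hy)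
    have hx : (extChartAt I x₀).symm y ∈ (trivializationAt E (TangentSpace I) x₀).baseSet := by
      simpa using (extChartAt I x₀).map_target hy
    rw [(trivializationAt E (TangentSpace I) x₀).contMDiffAt_iff
      ((trivializationAt E (TangentSpace I) x₀).mem_source.2 hx)]
    refine ⟨h1, contMDiffAt_const (c := a) |>.congr_of_eventuallyEq ?_⟩
    filter_upwards [hopen.mem_nhds hy] with y hy
    exact (trivializationAt_snd I ((extChartAt I x₀).map_target hy) _).trans
      (chartDeriv_chartSymmDeriv I hy a)
  have h1 := (contMDiffOn_extChartAt_symm (I := I) (n := ∞) x₀).contMDiffAt (hopen.mem_nhds hy)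
  have h2 : ContMDiffAt 𝓘(ℝ, E) (I.prod 𝓘(ℝ)) ∞
      (fun y ↦ Bundle.TotalSpace.mk' ℝ (E := Bundle.Trivial M ℝ) ((extChartAt I x₀).symm y)
        (g.inner ((extChartAt I x₀).symm y) (chartSymmDeriv I x₀ y u)
          (chartSymmDeriv I x₀ y v))) y := by
    apply ContMDiffAt.clm_bundle_apply₂ (F₁ := E) (F₂ := E)
    · exact g.contMDiff.contMDiffAt.comp y h1
    · exact hsec u
    · exact hsec v
  rw [Bundle.contMDiffAt_totalSpace] at h2
  exact h2.2.contDiffAt.contDiffWithinAt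

end Charts

/-! ### Total geodesy in coordinates -/

section TotallyGeodesic

variable {E : Type*} [NormedAddCommGroup E] [NormedSpace ℝ E]
  {H : Type*} [TopologicalSpace H] (I : ModelWithCorners ℝ E H) [I.Boundaryless]
  {M : Type*} [TopologicalSpace M] [ChartedSpace H M]
  {E' : Type*} [NormedAddCommGroup E'] [NormedSpace ℝ E']
  {H' : Type*} [TopologicalSpace H'] (I' : ModelWithCorners ℝ E' H') [I'.Boundaryless]
  {F : Type*} [TopologicalSpace F] [ChartedSpace H' F] {f : F → M} {p : F}

/-- Only the germ of the metric matters, so the Sasaki coefficients may be replaced by the model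
near the point. -/
theorem secondForm_congr {h k : E → E →L[ℝ] E →L[ℝ] ℝ} {c : E' → E} {x : E'}
    (hk : h =ᶠ[𝓝 (c x)] k) (u w : E') : secondForm h c x u w = secondForm k c x u w := by
  have : christoffelMap h (c x) = christoffelMap k (c x) := by
    rw [christoffelMap, christoffelMap, hk.fderiv_eq, hk.eq_of_nhds]
  rw [secondForm, secondForm, this, hk.eq_of_nhds]

omit [I.Boundaryless] in
theorem contDiffAt_writtenInExtChartAt (hf : ContMDiffAt I' I ∞ f p) :
    ContDiffAt ℝ ∞ (writtenInExtChartAt I' I p f) (extChartAt I' p p) := by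
  have := (contMDiffAt_iff.1 hf).2
  rw [I'.range_eq_univ, contDiffWithinAt_univ] at this
  exact this

omit [I.Boundaryless] in
theorem mfderiv_eq_fderiv_writtenInExtChartAt (hf : MDifferentiableAt I' I f p) (u : E') :
    (mfderiv I' I f p : E' →L[ℝ] E) u =
      fderiv ℝ (writtenInExtChartAt I' I p f) (extChartAt I' p p) u := by
  have h : (mfderiv I' I f p : E' →L[ℝ] E) =
      fderivWithin ℝ (writtenInExtChartAt I' I p f) (Set.range I') (extChartAt I' p p) := by
    unfold mfderiv
    exact if_pos hf
  rw [I'.range_eq_univ, fderivWithin_univ] at h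
  exact congrArg (fun L : E' →L[ℝ] E ↦ L u) h

omit [I.Boundaryless] [I'.Boundaryless] in
theorem writtenInExtChartAt_self : writtenInExtChartAt I' I p f (extChartAt I' p p) =
    extChartAt I (f p) (f p) := by
  simp [writtenInExtChartAt]

variable [IsManifold I ∞ M] [IsManifold I' ∞ F]

omit [I.Boundaryless] in
theorem fderiv_writtenInExtChartAt_apply {x : E'} (hx : x ∈ (extChartAt I' p).target)
    (hfx : f ((extChartAt I' p).symm x) ∈ (extChartAt I (f p)).source)
    (hf : MDifferentiableAt I' I f ((extChartAt I' p).symm x)) (w : E') :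
    fderiv ℝ (writtenInExtChartAt I' I p f) x w =
      chartDeriv I (f p) (f ((extChartAt I' p).symm x))
        ((mfderiv I' I f ((extChartAt I' p).symm x) : E' →L[ℝ] E) (chartSymmDeriv I' p x w)) := by
  have h1 := mdifferentiableAt_extChartAt_symm I' hx
  have h2 := hf.comp x h1
  have h3 : MDifferentiableAt I 𝓘(ℝ, E) (extChartAt I (f p))
      ((f ∘ (extChartAt I' p).symm) x) :=
    mdifferentiableAt_extChartAt (by rwa [← extChartAt_source I])
  have h4 := mfderiv_comp x h3 h2
  rw [mfderiv_comp x hf h1, mfderiv_eq_fderiv] at h4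
  exact congrArg (fun L : E' →L[ℝ] E ↦ L w) h4

omit [I.Boundaryless] in
theorem eventually_fderiv_writtenInExtChartAt (hf : ContMDiff I' I ∞ f) :
    ∀ᶠ q in 𝓝 p, q ∈ (extChartAt I' p).source ∧ f q ∈ (extChartAt I (f p)).source ∧
      ∀ w : E', fderiv ℝ (writtenInExtChartAt I' I p f) (extChartAt I' p q) (chartDeriv I' p q w) =
        chartDeriv I (f p) (f q) ((mfderiv I' I f q : E' →L[ℝ] E) w) := by
  filter_upwards [extChartAt_source_mem_nhds (I := I') p,
    hf.continuous.continuousAt.preimage_mem_nhds (extChartAt_source_mem_nhds (I := I) (f p))]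
    with q hq hfq
  refine ⟨hq, hfq, fun w ↦ ?_⟩
  have hl := (extChartAt I' p).left_inv hq
  have := fderiv_writtenInExtChartAt_apply I I' (f := f) ((extChartAt I' p).map_source hq)
    (by rwa [hl]) (by rw [hl]; exact hf.mdifferentiableAt (by simp)) (chartDeriv I' p q w)
  rw [chartSymmDeriv_chartDeriv' I' hq] at this
  rw [this, hl]

theorem contDiffAt_chartDeriv_section {Y : ∀ q : F, TangentSpace I' q}
    (hY : ContMDiffAt I' I'.tangent ∞ (fun q ↦ (⟨q, Y q⟩ : TangentBundle I' F)) p) :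
    ContDiffAt ℝ ∞ (fun x ↦ chartDeriv I' p ((extChartAt I' p).symm x)
      (Y ((extChartAt I' p).symm x))) (extChartAt I' p p) := by
  have h1 := (Bundle.contMDiffAt_section p).1 hY
  have h2 := (contMDiffOn_extChartAt_symm (I := I') (n := ∞) p).contMDiffAt
    (extChartAt_target_mem_nhds (I := I') p)
  rw [← (extChartAt I' p).left_inv (mem_extChartAt_source p)] at h1
  have h3 := (h1.comp (extChartAt I' p p) h2).contDiffAt
  rw [(extChartAt I' p).left_inv (mem_extChartAt_source p)] at h3
  refine h3.congr_of_eventuallyEq ?_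
  filter_upwards [extChartAt_target_mem_nhds (I := I') p] with x hx
  exact (trivializationAt_snd I' ((extChartAt I' p).map_target hx) _).symm

/-- The field with constant coordinates in the chart at `p` extends the given vector. -/
theorem exists_contMDiffAt_section (p : F) (w : E') :
    ∃ Y : ∀ q : F, TangentSpace I' q, Y p = w ∧
      ContMDiffAt I' I'.tangent ∞ (fun q ↦ (⟨q, Y q⟩ : TangentBundle I' F)) p := by
  refine ⟨fun q ↦ chartSymmDeriv I' p (extChartAt I' p q) w, ?_, ?_⟩
  · exact congrArg (fun L ↦ L w) (chartSymmDeriv_self I' p)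
  · refine (Bundle.contMDiffAt_section p).2 ?_
    refine (contMDiffAt_const (c := w)).congr_of_eventuallyEq ?_
    filter_upwards [extChartAt_source_mem_nhds (I := I') p] with q hq
    exact (trivializationAt_snd I' hq _).trans (chartDeriv_chartSymmDeriv' I' hq w)

/-- Up to a tangent vector, the covariant derivative of a tangent field depends only
on its value at the foot point. -/
theorem covDerivAlong_mfderiv (g : MetricField I M) (hf : ContMDiff I' I ∞ f)
    {Y : ∀ q : F, TangentSpace I' q}
    (hY : ContMDiffAt I' I'.tangent ∞ (fun q ↦ (⟨q, Y q⟩ : TangentBundle I' F)) p)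
    (u : E') : ∃ t : E', ∀ ν : E,
      (g (f p) : E →L[ℝ] E →L[ℝ] ℝ)
        (covDerivAlong I I' g f (fun q ↦ mfderiv I' I f q (Y q)) p u) ν =
      secondForm (gramInChart I g (f p)) (writtenInExtChartAt I' I p f) (extChartAt I' p p)
        u (Y p) ν + (g (f p) : E →L[ℝ] E →L[ℝ] ℝ) ((mfderiv I' I f p : E' →L[ℝ] E) t) ν := by
  let y : E' := Y p
  set c := writtenInExtChartAt I' I p f with hc
  set x₀ := extChartAt I' p p with hx₀
  set Z : E' → E' := fun x ↦ chartDeriv I' p ((extChartAt I' p).symm x)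
      (Y ((extChartAt I' p).symm x)) with hZ
  have hc2 : ContDiffAt ℝ ∞ c x₀ := contDiffAt_writtenInExtChartAt I I' hf.contMDiffAt
  have hZ1 : HasFDerivAt Z (fderiv ℝ Z x₀) x₀ :=
    ((contDiffAt_chartDeriv_section I' hY).differentiableAt (by simp)).hasFDerivAt
  have hZ0 : Z x₀ = y := by
    -- The point is generalized first because the type of `Y q` depends on it.
    have : ∀ q, q = p → chartDeriv I' p q (Y q) = Y p := by
      rintro q rfl; rw [chartDeriv_self]; rfl
    exact this _ ((extChartAt I' p).left_inv (mem_extChartAt_source p))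
  have hDc : HasFDerivAt (fderiv ℝ c) (fderiv ℝ (fderiv ℝ c) x₀) x₀ :=
    ((hc2.fderiv_right (m := ∞) (by simp)).differentiableAt (by simp)).hasFDerivAt
  have hW := hDc.clm_apply hZ1
  have hV : (fun q ↦ (mfderiv I 𝓘(ℝ, E) (extChartAt I (f p)) (f q) (mfderiv I' I f q (Y q)) : E))
      =ᶠ[𝓝 p] (fun x ↦ fderiv ℝ c x (Z x)) ∘ extChartAt I' p := by
    filter_upwards [eventually_fderiv_writtenInExtChartAt I I' (p := p) hf] with q hq
    have h1 := hq.2.2 (Y q)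
    have h2 : Z (extChartAt I' p q) = chartDeriv I' p q (Y q) := by
      have : ∀ r, r = q → chartDeriv I' p r (Y r) = chartDeriv I' p q (Y q) := by
        rintro _ rfl; rfl
      exact this _ ((extChartAt I' p).left_inv hq.1)
    exact h1.symm.trans (congrArg (fderiv ℝ c (extChartAt I' p q)) h2.symm)
  have hD : (mfderiv I' 𝓘(ℝ, E) (fun q ↦ (mfderiv I 𝓘(ℝ, E) (extChartAt I (f p)) (f q)
      (mfderiv I' I f q (Y q)) : E)) p : E' →L[ℝ] E) u =
      fderiv ℝ (fderiv ℝ c) x₀ u y + fderiv ℝ c x₀ (fderiv ℝ Z x₀ u) := by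
    have h1 : MDifferentiableAt 𝓘(ℝ, E') 𝓘(ℝ, E) (fun x ↦ fderiv ℝ c x (Z x))
      (extChartAt I' p p) := hW.differentiableAt.mdifferentiableAt
    have h2 : MDifferentiableAt I' 𝓘(ℝ, E') (extChartAt I' p) p :=
      mdifferentiableAt_extChartAt (mem_chart_source _ _)
    have h3 := mfderiv_comp p h1 h2
    rw [hV.mfderiv_eq, h3, mfderiv_eq_fderiv, hW.fderiv]
    have h4 : (mfderiv I' 𝓘(ℝ, E') (extChartAt I' p) p : E' →L[ℝ] E') u = u :=
      congrArg (fun L : E' →L[ℝ] E' ↦ L u) (chartDeriv_self I' p)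
    change ((fderiv ℝ c x₀).comp (fderiv ℝ Z x₀) + (fderiv ℝ (fderiv ℝ c) x₀).flip (Z x₀))
      ((mfderiv I' 𝓘(ℝ, E') (extChartAt I' p) p : E' →L[ℝ] E') u) = _
    rw [h4, hZ0]
    exact add_comm _ _
  have hfp (w : E') : (mfderiv I' I f p : E' →L[ℝ] E) w = fderiv ℝ c x₀ w :=
    mfderiv_eq_fderiv_writtenInExtChartAt I I' (hf.mdifferentiableAt (by simp)) w
  have hcx : c x₀ = extChartAt I (f p) (f p) := writtenInExtChartAt_self I I'
  -- The derivative of the coordinates of `Y` contributes only a tangent vector to the covariant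
  -- derivative.
  refine ⟨fderiv ℝ Z x₀ u, fun ν ↦ ?_⟩
  have hcov : (covDerivAlong I I' g f (fun q ↦ mfderiv I' I f q (Y q)) p u : E) =
      (fderiv ℝ (fderiv ℝ c) x₀ u y + fderiv ℝ c x₀ (fderiv ℝ Z x₀ u)) +
        christoffelMap (gramInChart I g (f p)) (c x₀) (fderiv ℝ c x₀ u) (fderiv ℝ c x₀ y) := by
    rw [← christoffel_eq, ← hfp u, ← hfp y, ← hD, hcx]
    rfl
  change _ = gramInChart I g (f p) (c x₀) (fderiv ℝ (fderiv ℝ c) x₀ u y +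
    christoffelMap (gramInChart I g (f p)) (c x₀) (fderiv ℝ c x₀ u) (fderiv ℝ c x₀ y)) ν + _
  have hg : (g (f p) : E →L[ℝ] E →L[ℝ] ℝ) = gramInChart I g (f p) (c x₀) := by
    rw [hcx, gramInChart_self]
  rw [hcov, hfp, hg]
  have key : ∀ (B : E →L[ℝ] E →L[ℝ] ℝ) (a b c : E), B (a + b + c) ν = B (a + c) ν + B b ν := by
    intro B a b c
    simp only [map_add, add_apply]
    ring
  exact key _ _ _ _

/-- A normal vector annihilates the tangential error term of `covDerivAlong_mfderiv`, so the
condition depends on `Y` only through its value at `p`, and every value occurs. -/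
theorem isTotallyGeodesic_iff (g : MetricField I M) (hf : ContMDiff I' I ∞ f) :
    IsTotallyGeodesic I I' g f ↔ ∀ (p : F) (u w : E') (ν : E),
      (∀ t : E', gramInChart I g (f p) (extChartAt I (f p) (f p))
        (fderiv ℝ (writtenInExtChartAt I' I p f) (extChartAt I' p p) t) ν = 0) →
      secondForm (gramInChart I g (f p)) (writtenInExtChartAt I' I p f) (extChartAt I' p p)
        u w ν = 0 := by
  have hfp (p : F) (w : E') : (mfderiv I' I f p : E' →L[ℝ] E) w =
      fderiv ℝ (writtenInExtChartAt I' I p f) (extChartAt I' p p) w :=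
    mfderiv_eq_fderiv_writtenInExtChartAt I I' (hf.mdifferentiableAt (by simp)) w
  constructor
  · intro h p u w ν hν
    obtain ⟨Y, rfl, hY⟩ := exists_contMDiffAt_section I' p w
    obtain ⟨t, ht⟩ := covDerivAlong_mfderiv I I' g hf hY u
    have hν' (t : E') :
        (g (f p) : E →L[ℝ] E →L[ℝ] ℝ) ((mfderiv I' I f p : E' →L[ℝ] E) t) ν = 0 := by
      rw [hfp, ← gramInChart_self I g (f p)]; exact hν t
    have h0 := ht ν
    rw [hν', add_zero] at h0
    rw [← h0]
    exact h p u Y hY ν hν'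
  · intro h p u Y hY ν hν
    obtain ⟨t, ht⟩ := covDerivAlong_mfderiv I I' g hf hY u
    refine (ht ν).trans ?_
    have h1 : (g (f p) : E →L[ℝ] E →L[ℝ] ℝ) ((mfderiv I' I f p : E' →L[ℝ] E) t) ν = 0 := hν t
    rw [h1, add_zero]
    refine h p u (Y p) ν fun t ↦ ?_
    rw [gramInChart_self, ← hfp]
    exact hν t

end TotallyGeodesic

/-! ### Induced charts of the tangent bundle -/

section TangentBundleCharts

variable {E : Type*} [NormedAddCommGroup E] [NormedSpace ℝ E]
  {H : Type*} [TopologicalSpace H] (I : ModelWithCorners ℝ E H) [I.Boundaryless]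
  {M : Type*} [TopologicalSpace M] [ChartedSpace H M] [IsManifold I ∞ M]

theorem two_le_infty : (2 : WithTop ℕ∞) ≤ ∞ := by
  exact WithTop.coe_le_coe.2 (le_top : (2 : ℕ∞) ≤ ⊤)

/-- The vector part of a point of the tangent bundle, as an element of the model space. -/
def vectorPart (z : TangentBundle I M) : E := z.snd

/-- The connection map, between the model spaces. -/
def connectionMapModel (g : MetricField I M) (z : TangentBundle I M) : E × E →L[ℝ] E :=
  connectionMap I g z

/-- The differential of the projection of the tangent bundle, between the model spaces. -/
def projDeriv (z : TangentBundle I M) : E × E →L[ℝ] E :=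
  mfderiv I.tangent I (Bundle.TotalSpace.proj : TangentBundle I M → M) z

omit [I.Boundaryless] in
theorem extChartAt_tangentBundle_apply {z₀ z : TangentBundle I M}
    (hz : z.proj ∈ (extChartAt I z₀.proj).source) : extChartAt I.tangent z₀ z =
      (extChartAt I z₀.proj z.proj, chartDeriv I z₀.proj z.proj (vectorPart I z)) :=
  Prod.ext rfl (trivializationAt_snd I hz z.snd)

omit [I.Boundaryless] in
theorem mem_extChartAt_tangentBundle_source {z₀ z : TangentBundle I M} :
    z ∈ (extChartAt I.tangent z₀).source ↔ z.proj ∈ (extChartAt I z₀.proj).source := by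
  rw [extChartAt_source, extChartAt_source, TangentBundle.mem_chart_source_iff]

omit [I.Boundaryless] in
theorem mem_extChartAt_tangentBundle_target {z₀ : TangentBundle I M} {y : E × E} :
    y ∈ (extChartAt I.tangent z₀).target ↔ y.1 ∈ (extChartAt I z₀.proj).target := by
  rw [FiberBundle.extChartAt_target]
  simp only [Set.mem_inter_iff, Set.mem_prod, Set.mem_univ, and_true, Set.mem_preimage,
    and_iff_left_iff_imp]
  intro h
  simpa using (extChartAt I z₀.proj).map_target h

/-- The coordinate change between two charts. -/
def coordChange (x₁ x₀ : M) : E → E := extChartAt I x₀ ∘ (extChartAt I x₁).symm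

variable {x₀ x₁ : M}

theorem contDiffAt_coordChange {y : E} (hy : y ∈ (extChartAt I x₁).target)
    (hy' : (extChartAt I x₁).symm y ∈ (extChartAt I x₀).source) :
    ContDiffAt ℝ ∞ (coordChange I x₁ x₀) y := by
  have h1 := (contMDiffOn_extChartAt_symm (I := I) (n := ∞) x₁).contMDiffAt
    ((isOpen_extChartAt_target x₁).mem_nhds hy)
  have h2 : ContMDiffAt I 𝓘(ℝ, E) ∞ (extChartAt I x₀) ((extChartAt I x₁).symm y) :=
    contMDiffAt_extChartAt' (by rwa [← extChartAt_source I])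
  exact (h2.comp y h1).contDiffAt

theorem fderiv_coordChange {y : E} (hy : y ∈ (extChartAt I x₁).target)
    (hy' : (extChartAt I x₁).symm y ∈ (extChartAt I x₀).source) (v : E) :
    fderiv ℝ (coordChange I x₁ x₀) y v =
      chartDeriv I x₀ ((extChartAt I x₁).symm y) (chartSymmDeriv I x₁ y v) := by
  have h1 := mdifferentiableAt_extChartAt_symm I hy
  have h2 : MDifferentiableAt I 𝓘(ℝ, E) (extChartAt I x₀) ((extChartAt I x₁).symm y) :=
    mdifferentiableAt_extChartAt (by rwa [← extChartAt_source I])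
  have h3 := mfderiv_comp y h2 h1
  rw [mfderiv_eq_fderiv] at h3
  exact congrArg (fun L : E →L[ℝ] E ↦ L v) h3

theorem eventually_coordChange {x : M} (hx : x ∈ (extChartAt I x₁).source)
    (hx' : x ∈ (extChartAt I x₀).source) : ∀ᶠ y in 𝓝 (extChartAt I x₁ x),
    y ∈ (extChartAt I x₁).target ∧ (extChartAt I x₁).symm y ∈ (extChartAt I x₀).source := by
  have h1 := (isOpen_extChartAt_target (I := I) x₁).mem_nhds ((extChartAt I x₁).map_source hx)
  have h2 := (contMDiffOn_extChartAt_symm (I := I) (n := ∞) x₁).contMDiffAt h1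
  filter_upwards [h1, h2.continuousAt.preimage_mem_nhds ((isOpen_extChartAt_source x₀).mem_nhds
    (by rwa [(extChartAt I x₁).left_inv hx]))] with y hy hy'
  exact ⟨hy, hy'⟩

/-- Fibre coordinates transform by the differential of the base change. Its derivative is the source
of the Hessian term in `chartDeriv_tangentBundle`. -/
theorem coordChange_tangentBundle {z₀ z₁ : TangentBundle I M} {y : E × E}
    (hy : y.1 ∈ (extChartAt I z₁.proj).target)
    (hy' : (extChartAt I z₁.proj).symm y.1 ∈ (extChartAt I z₀.proj).source) :
    coordChange I.tangent z₁ z₀ y = (coordChange I z₁.proj z₀.proj y.1,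
      fderiv ℝ (coordChange I z₁.proj z₀.proj) y.1 y.2) := by
  have hyt := mem_extChartAt_tangentBundle_target I (z₀ := z₁) |>.2 hy
  have h1 := (extChartAt I.tangent z₁).right_inv hyt
  have hs := (extChartAt I z₁.proj).map_target hy
  rw [extChartAt_tangentBundle_apply I hs] at h1
  have h2 := congrArg Prod.snd h1
  have h3 := chartSymmDeriv_chartDeriv' I hs (vectorPart I ((extChartAt I.tangent z₁).symm y))
  rw [fderiv_coordChange I hy hy', coordChange, Function.comp_apply,
    extChartAt_tangentBundle_apply I hy', ← h2]
  refine Prod.ext rfl ?_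
  refine congrArg (chartDeriv I z₀.proj ((extChartAt I z₁.proj).symm y.1)) ?_
  rw [(extChartAt I z₁.proj).right_inv hy] at h3
  exact h3.symm

theorem chartDeriv_eq_fderiv_coordChange (x : M) (hx : x ∈ (extChartAt I x₀).source) (v : E) :
    chartDeriv I x₀ x v = fderiv ℝ (coordChange I x x₀) (extChartAt I x x) v := by
  have hl := (extChartAt I x).left_inv (mem_extChartAt_source (I := I) x)
  rw [fderiv_coordChange I (mem_extChartAt_target x) (by rwa [hl]), chartSymmDeriv_self, hl]
  rfl

/-- The differential of a chart of the tangent bundle. -/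
theorem chartDeriv_tangentBundle {z₀ z : TangentBundle I M}
    (hz : z.proj ∈ (extChartAt I z₀.proj).source) (X : E × E) :
    chartDeriv I.tangent z₀ z X = (chartDeriv I z₀.proj z.proj X.1,
      fderiv ℝ (fderiv ℝ (coordChange I z.proj z₀.proj)) (extChartAt I z.proj z.proj) X.1
        (vectorPart I z) +
        chartDeriv I z₀.proj z.proj X.2) := by
  set σ := coordChange I z.proj z₀.proj
  set y := extChartAt I z.proj z.proj
  have hself := mem_extChartAt_source (I := I) z.proj
  have hσ : ContDiffAt ℝ ∞ σ y := contDiffAt_coordChange I (mem_extChartAt_target z.proj)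
    (by rwa [(extChartAt I z.proj).left_inv hself])
  have e : coordChange I.tangent z z₀ =ᶠ[𝓝 (y, vectorPart I z)]
      fun w ↦ (σ w.1, fderiv ℝ σ w.1 w.2) := by
    filter_upwards [continuousAt_fst.eventually (eventually_coordChange I hself hz)] with w hw
    exact coordChange_tangentBundle I hw.1 hw.2
  have h1 : HasFDerivAt σ _ y := (hσ.differentiableAt (by simp)).hasFDerivAt
  have h2 : HasFDerivAt (fderiv ℝ σ) _ y :=
    ((hσ.fderiv_right (m := ∞) (by simp)).differentiableAt (by simp)).hasFDerivAt
  have h3 : HasFDerivAt (fun w : E × E ↦ σ w.1) _ (y, vectorPart I z) :=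
    HasFDerivAt.comp (g := σ) (y, vectorPart I z) h1 hasFDerivAt_fst
  have h4 : HasFDerivAt (fun w : E × E ↦ fderiv ℝ σ w.1) _ (y, vectorPart I z) :=
    h2.comp (y, vectorPart I z) hasFDerivAt_fst
  have h5 := h3.prodMk (h4.clm_apply hasFDerivAt_snd)
  have hzz : extChartAt I.tangent z z = (y, vectorPart I z) := by
    rw [extChartAt_tangentBundle_apply I hself, chartDeriv_self]
    rfl
  rw [chartDeriv_eq_fderiv_coordChange I.tangent z
    ((mem_extChartAt_tangentBundle_source I).2 hz), hzz, e.fderiv_eq, h5.fderiv,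
    chartDeriv_eq_fderiv_coordChange I _ hz, chartDeriv_eq_fderiv_coordChange I _ hz]
  simp [σ, y, add_comm]

omit [I.Boundaryless] in
theorem connectionMap_apply (g : MetricField I M) (z : TangentBundle I M) (X : E × E) :
    connectionMapModel I g z X = X.2 + christoffelMap (gramInChart I g z.proj)
      (extChartAt I z.proj z.proj) (vectorPart I z) X.1 := by
  have h : connectionMapModel I g z X = (chartDeriv I.tangent z z X).2 +
    christoffel I g z.proj (extChartAt I z.proj z.proj) (vectorPart I z)
      (chartDeriv I.tangent z z X).1 := rfl
  rw [h, chartDeriv_self, christoffel_eq]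
  rfl

variable [FiniteDimensional ℝ E]
  (g : Bundle.ContMDiffRiemannianMetric I ∞ E (fun x : M ↦ TangentSpace I x))

/-- The expression of the connection map in an arbitrary chart. -/
theorem chartDeriv_connectionMap {z₀ z : TangentBundle I M}
    (hz : z.proj ∈ (extChartAt I z₀.proj).source) (X : E × E) :
    chartDeriv I z₀.proj z.proj (connectionMapModel I g.inner z X) =
      connectionModel (gramInChart I g.inner z₀.proj) (extChartAt I.tangent z₀ z)
        (chartDeriv I.tangent z₀ z X) := by
  set σ := coordChange I z.proj z₀.proj
  have hself := mem_extChartAt_source (I := I) z.proj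
  have hl := (extChartAt I z.proj).left_inv hself
  have hd (v : E) : chartDeriv I z₀.proj z.proj v =
      fderiv ℝ σ (extChartAt I z.proj z.proj) v := chartDeriv_eq_fderiv_coordChange I _ hz v
  have hσ : ContDiffAt ℝ ∞ σ (extChartAt I z.proj z.proj) :=
    contDiffAt_coordChange I (mem_extChartAt_target z.proj) (by rwa [hl])
  have hσy : σ (extChartAt I z.proj z.proj) = extChartAt I z₀.proj z.proj := by
    simp only [σ, coordChange, Function.comp_apply, hl]
  have ht := mem_extChartAt_target (I := I) z.proj
  have ht' := (extChartAt I z₀.proj).map_source hz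
  have hpos {x₀ : M} {y : E} (hy : y ∈ (extChartAt I x₀).target) (v : E) (hv : v ≠ 0) :=
    gramInChart_pos I g.inner g.pos hy v hv
  have hdiff {x₀ : M} {y : E} (hy : y ∈ (extChartAt I x₀).target) :=
    (contDiffAt_gramInChart I g hy).differentiableAt (by simp)
  have key := christoffelMap_pullback (h := gramInChart I g.inner z.proj)
    (k := gramInChart I g.inner z₀.proj) (σ := σ) (y := extChartAt I z.proj z.proj)
    (hσ.of_le two_le_infty) (by
      filter_upwards [eventually_coordChange I hself hz] with y hy v w
      rw [fderiv_coordChange I hy.1 hy.2, fderiv_coordChange I hy.1 hy.2]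
      exact (gramInChart_chartDeriv I g.inner hy.2 _ _).symm)
    (hdiff ht) (hdiff (by rwa [hσy])) (gramInChart_symm I g.inner g.symm)
    (isInvertible_of_pos _ (hpos ht)) (hpos (by rwa [hσy]))
    (isInvertible_of_pos _ (hpos (by rwa [hσy])))
    (fun v ↦ ⟨_, (hd _).symm.trans (chartDeriv_chartSymmDeriv' I hz v)⟩)
  have hsym : ∀ u v, fderiv ℝ (fderiv ℝ σ) (extChartAt I z.proj z.proj) u v =
      fderiv ℝ (fderiv ℝ σ) (extChartAt I z.proj z.proj) v u :=
    fun u v ↦ ((hσ.of_le two_le_infty).isSymmSndFDerivAt (by simp)) u v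
  rw [connectionMap_apply, chartDeriv_tangentBundle I hz, connectionModel_apply,
    extChartAt_tangentBundle_apply I hz, map_add]
  simp only [hd]
  -- The Hessian term from the Christoffel symbols cancels the one from the tangent bundle chart;
  -- they differ by the order of their arguments.
  rw [key, hσy, hsym (vectorPart I z) X.1]
  abel

/-- The Sasaki metric in the coordinates of the tangent bundle induced by a chart. -/
theorem gramInChart_sasakiMetric {z₀ : TangentBundle I M} {y : E × E}
    (hy : y.1 ∈ (extChartAt I z₀.proj).target) :
    gramInChart I.tangent (sasakiMetric I g.inner) z₀ y =
      sasakiModel (gramInChart I g.inner z₀.proj) y := by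
  have hyt := mem_extChartAt_tangentBundle_target I (z₀ := z₀) |>.2 hy
  have hs := (extChartAt I z₀.proj).map_target hy
  set z := (extChartAt I.tangent z₀).symm y with hz
  have hzs : z.proj ∈ (extChartAt I z₀.proj).source := hs
  have hzy : extChartAt I.tangent z₀ z = y := (extChartAt I.tangent z₀).right_inv hyt
  refine ContinuousLinearMap.ext fun P ↦ ContinuousLinearMap.ext fun Q ↦ ?_
  -- In induced charts the bundle projection is the first projection.
  have hπ (P : E × E) : chartDeriv I z₀.proj z.proj (projDeriv I z
        (chartSymmDeriv I.tangent z₀ y P)) = P.1 := by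
    have h1 : MDifferentiableAt I.tangent I (Bundle.TotalSpace.proj : TangentBundle I M → M) z :=
      (Bundle.contMDiff_proj (n := 1) (IB := I) (TangentSpace I : M → Type _)).mdifferentiableAt
        (by simp)
    have h2 : MDifferentiableAt I 𝓘(ℝ, E) (extChartAt I z₀.proj) z.proj :=
      mdifferentiableAt_extChartAt (by rwa [← extChartAt_source I])
    have h3 : MDifferentiableAt I.tangent 𝓘(ℝ, E × E) (extChartAt I.tangent z₀) z :=
      mdifferentiableAt_extChartAt (by
        rw [← extChartAt_source I.tangent]; exact (mem_extChartAt_tangentBundle_source I).2 hzs)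
    have h4 : MDifferentiableAt 𝓘(ℝ, E × E) 𝓘(ℝ, E) (Prod.fst : E × E → E)
      (extChartAt I.tangent z₀ z) := differentiableAt_fst.mdifferentiableAt
    have h5 := mfderiv_comp z h2 h1
    have h6 := mfderiv_comp z h4 h3
    rw [mfderiv_eq_fderiv, fderiv_fst] at h6
    have h7 : chartDeriv I z₀.proj z.proj ∘L projDeriv I z =
      ContinuousLinearMap.fst ℝ E E ∘L chartDeriv I.tangent z₀ z := h5.symm.trans h6
    have h8 := congrArg (fun L ↦ L (chartSymmDeriv I.tangent z₀ y P)) h7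
    refine h8.trans ?_
    exact congrArg Prod.fst (chartDeriv_chartSymmDeriv I.tangent hyt P)
  have hK (P : E × E) : chartDeriv I z₀.proj z.proj (connectionMapModel I g.inner z
        (chartSymmDeriv I.tangent z₀ y P)) =
        connectionModel (gramInChart I g.inner z₀.proj) y P := by
    rw [chartDeriv_connectionMap I g hzs, hzy, hz, chartDeriv_chartSymmDeriv I.tangent hyt]
  have hzy1 : extChartAt I z₀.proj z.proj = y.1 := congrArg Prod.fst hzy
  rw [sasakiModel_apply, ← hπ P, ← hπ Q, ← hK P, ← hK Q, ← hzy1,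
    gramInChart_chartDeriv I g.inner hzs, gramInChart_chartDeriv I g.inner hzs]
  rfl

end TangentBundleCharts

/-! ### Vector fields along a map as maps into the tangent bundle -/

section Main

variable {E : Type*} [NormedAddCommGroup E] [NormedSpace ℝ E]
  {H : Type*} [TopologicalSpace H] (I : ModelWithCorners ℝ E H) [I.Boundaryless]
  {M : Type*} [TopologicalSpace M] [ChartedSpace H M] [IsManifold I ∞ M]
  {E' : Type*} [NormedAddCommGroup E'] [NormedSpace ℝ E']
  {H' : Type*} [TopologicalSpace H'] (I' : ModelWithCorners ℝ E' H') [I'.Boundaryless]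
  {F : Type*} [TopologicalSpace F] [ChartedSpace H' F] [IsManifold I' ∞ F]

omit [I.Boundaryless] in
theorem extChartAt_tangentBundle_self (z : TangentBundle I M) :
    extChartAt I.tangent z z = (extChartAt I z.proj z.proj, vectorPart I z) := by
  rw [extChartAt_tangentBundle_apply I (mem_extChartAt_source _), chartDeriv_self]
  rfl

variable [FiniteDimensional ℝ E]
  (g : Bundle.ContMDiffRiemannianMetric I ∞ E (fun x : M ↦ TangentSpace I x))
  {Φ : F → TangentBundle I M} {p : F}

omit [I.Boundaryless] [IsManifold I' ∞ F] [FiniteDimensional ℝ E] in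
theorem fderiv_fst_writtenInExtChartAt (hΦ : ContMDiff I' I.tangent ∞ Φ) (p : F) (w : E') :
    fderiv ℝ (writtenInExtChartAt I' I p fun q ↦ (Φ q).proj) (extChartAt I' p p) w =
      (fderiv ℝ (writtenInExtChartAt I' I.tangent p Φ) (extChartAt I' p p) w).1 := by
  have h1 := ((contDiffAt_writtenInExtChartAt I.tangent I' (hΦ p)).differentiableAt
    (by simp)).hasFDerivAt
  have h2 : HasFDerivAt (writtenInExtChartAt I' I p fun q ↦ (Φ q).proj) _ (extChartAt I' p p) :=
    h1.fst
  rw [h2.fderiv]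
  rfl

theorem eventually_chart (p : F) {P : F → Prop} (hP : ∀ᶠ q in 𝓝 p, P q) :
    ∀ᶠ y in 𝓝 (extChartAt I' p p), P ((extChartAt I' p).symm y) := by
  have h := (contMDiffOn_extChartAt_symm (I := I') (n := ∞) p).contMDiffAt
    (extChartAt_target_mem_nhds (I := I') p)
  have h1 : Filter.Tendsto (extChartAt I' p).symm (𝓝 (extChartAt I' p p)) (𝓝 p) := by
    have := h.continuousAt.tendsto
    rwa [(extChartAt I' p).left_inv (mem_extChartAt_source p)] at this
  exact h1.eventually hP

/-- The covariant derivative of a field along a map is the vertical part of its velocity as a curve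
in the tangent bundle. -/
theorem covDerivAlong_eq (hΦ : ContMDiff I' I.tangent ∞ Φ) (p : F) (u : E') :
    (covDerivAlong I I' g.inner (fun q ↦ (Φ q).proj) (fun q ↦ (Φ q).snd) p u : E) =
      connectionMapModel I g.inner (Φ p) ((mfderiv I' I.tangent Φ p : E' →L[ℝ] E × E) u) := by
  set c := writtenInExtChartAt I' I.tangent p Φ with hc
  set x₀ := extChartAt I' p p with hx₀
  have hι : ContMDiff I' I ∞ fun q ↦ (Φ q).proj :=
    (Bundle.contMDiff_proj (n := ∞) (IB := I) (TangentSpace I : M → Type _)).comp hΦ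
  have hΦp : (mfderiv I' I.tangent Φ p : E' →L[ℝ] E × E) u = fderiv ℝ c x₀ u :=
    mfderiv_eq_fderiv_writtenInExtChartAt I.tangent I' (hΦ.mdifferentiableAt (by simp)) u
  have hιp : (mfderiv I' I (fun q ↦ (Φ q).proj) p : E' →L[ℝ] E) u = (fderiv ℝ c x₀ u).1 :=
    (mfderiv_eq_fderiv_writtenInExtChartAt I I' (hι.mdifferentiableAt (by simp)) u).trans
      (fderiv_fst_writtenInExtChartAt I I' hΦ p u)
  have hcd := ((contDiffAt_writtenInExtChartAt I.tangent I' (hΦ p)).differentiableAt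
    (by simp)).hasFDerivAt
  have hV : (fun q ↦ (mfderiv I 𝓘(ℝ, E) (extChartAt I (Φ p).proj) (Φ q).proj (Φ q).snd : E))
      =ᶠ[𝓝 p] (fun x ↦ (c x).2) ∘ extChartAt I' p := by
    filter_upwards [extChartAt_source_mem_nhds (I := I') p,
      hι.continuous.continuousAt.preimage_mem_nhds
        (extChartAt_source_mem_nhds (I := I) (Φ p).proj)] with q hq hq'
    have h1 : c (extChartAt I' p q) = extChartAt I.tangent (Φ p) (Φ q) := by
      simp only [hc, writtenInExtChartAt, Function.comp_apply, (extChartAt I' p).left_inv hq]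
    rw [extChartAt_tangentBundle_apply I hq'] at h1
    exact (congrArg Prod.snd h1).symm
  have hD : (mfderiv I' 𝓘(ℝ, E) (fun q ↦ (mfderiv I 𝓘(ℝ, E) (extChartAt I (Φ p).proj)
      (Φ q).proj (Φ q).snd : E)) p : E' →L[ℝ] E) u = (fderiv ℝ c x₀ u).2 := by
    have h1 : MDifferentiableAt 𝓘(ℝ, E') 𝓘(ℝ, E) (fun x ↦ (c x).2) (extChartAt I' p p) :=
      hcd.snd.differentiableAt.mdifferentiableAt
    have h2 : MDifferentiableAt I' 𝓘(ℝ, E') (extChartAt I' p) p :=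
      mdifferentiableAt_extChartAt (mem_chart_source _ _)
    have h3 := mfderiv_comp p h1 h2
    rw [hV.mfderiv_eq, h3, mfderiv_eq_fderiv, hcd.snd.fderiv]
    exact congrArg (fun L : E' →L[ℝ] E' ↦ (fderiv ℝ c x₀ (L u)).2) (chartDeriv_self I' p)
  have e := connectionMap_apply I g.inner (Φ p) (fderiv ℝ c x₀ u)
  -- The covariant derivative pairs velocity with field and the connection map pairs field with
  -- velocity; absence of torsion identifies the two.
  rw [christoffelMap_symm
    ((contDiffAt_gramInChart I g (mem_extChartAt_target _)).differentiableAt (by simp))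
    (gramInChart_symm I g.inner g.symm), ← christoffel_eq, ← hιp, ← hD] at e
  exact ((congrArg (connectionMapModel I g.inner (Φ p)) hΦp).trans e).symm

theorem covDerivAlong_eq_connectionModel (hΦ : ContMDiff I' I.tangent ∞ Φ) (p : F) (u : E') :
    (covDerivAlong I I' g.inner (fun q ↦ (Φ q).proj) (fun q ↦ (Φ q).snd) p u : E) =
      connectionModel (gramInChart I g.inner (Φ p).proj)
        (writtenInExtChartAt I' I.tangent p Φ (extChartAt I' p p))
        (fderiv ℝ (writtenInExtChartAt I' I.tangent p Φ) (extChartAt I' p p) u) := by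
  refine (covDerivAlong_eq I I' g hΦ p u).trans
    ((congrArg (connectionMapModel I g.inner (Φ p)) (mfderiv_eq_fderiv_writtenInExtChartAt I.tangent
      I' (hΦ.mdifferentiableAt (by simp)) u)).trans ?_)
  rw [connectionMap_apply, connectionModel_apply,
    writtenInExtChartAt_self, extChartAt_tangentBundle_self]

/-- Parallelism at nearby points is read in the single chart at `p`, since the equation is going to
be differentiated there. -/
theorem eventually_connectionModel_eq_zero (hΦ : ContMDiff I' I.tangent ∞ Φ)
    (hpar : IsParallelAlong I I' g.inner (fun q ↦ (Φ q).proj) (fun q ↦ (Φ q).snd)) (p : F) :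
    ∀ᶠ y in 𝓝 (extChartAt I' p p), ∀ w,
      connectionModel (gramInChart I g.inner (Φ p).proj) (writtenInExtChartAt I' I.tangent p Φ y)
        (fderiv ℝ (writtenInExtChartAt I' I.tangent p Φ) y w) = 0 := by
  filter_upwards [eventually_chart I' p (eventually_fderiv_writtenInExtChartAt I.tangent I' hΦ),
    extChartAt_target_mem_nhds (I := I') p] with y hy hyt w
  obtain ⟨h1, h2, h3⟩ := hy
  have h4 := h3 (chartSymmDeriv I' p y w)
  rw [chartDeriv_chartSymmDeriv I' hyt, (extChartAt I' p).right_inv hyt] at h4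
  have h5 := chartDeriv_connectionMap I g ((mem_extChartAt_tangentBundle_source I).1 h2)
    ((mfderiv I' I.tangent Φ ((extChartAt I' p).symm y) : E' →L[ℝ] E × E)
      (chartSymmDeriv I' p y w))
  have h6 : (covDerivAlong I I' g.inner (fun q ↦ (Φ q).proj) (fun q ↦ (Φ q).snd)
      ((extChartAt I' p).symm y) (chartSymmDeriv I' p y w) : E) = 0 := hpar _ _
  have h7 := (congrArg (chartDeriv I (Φ p).proj (Φ ((extChartAt I' p).symm y)).proj)
    ((covDerivAlong_eq I I' g hΦ _ _).symm.trans h6)).trans (map_zero _)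
  exact (congrArg (connectionModel (gramInChart I g.inner (Φ p).proj) _) h4).trans
    (h5.symm.trans h7)

omit [FiniteDimensional ℝ E] in
theorem eventually_length_eq (hΦ : ContMDiff I' I.tangent ∞ Φ) {C : ℝ}
    (hlen : ∀ p, √(g.inner (Φ p).proj (Φ p).snd (Φ p).snd) = C) (p : F) :
    ∀ᶠ y in 𝓝 (extChartAt I' p p), gramInChart I g.inner (Φ p).proj
      (writtenInExtChartAt I' I.tangent p Φ y).1 (writtenInExtChartAt I' I.tangent p Φ y).2
      (writtenInExtChartAt I' I.tangent p Φ y).2 = C ^ 2 := by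
  filter_upwards [eventually_chart I' p (eventually_fderiv_writtenInExtChartAt I.tangent I' hΦ)]
    with y hy
  have h1 := (mem_extChartAt_tangentBundle_source I).1 hy.2.1
  have h2 : writtenInExtChartAt I' I.tangent p Φ y =
    extChartAt I.tangent (Φ p) (Φ ((extChartAt I' p).symm y)) := rfl
  rw [h2, extChartAt_tangentBundle_apply I h1, gramInChart_chartDeriv I g.inner h1, ← hlen,
    Real.sq_sqrt]
  · rfl
  · by_cases h0 : (Φ ((extChartAt I' p).symm y)).snd = 0
    · rw [h0, map_zero]
    · exact (g.pos _ _ h0).le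

theorem isTotallyGeodesic_sasakiMetric_iff (hΦ : ContMDiff I' I.tangent ∞ Φ) :
    IsTotallyGeodesic I.tangent I' (sasakiMetric I g.inner) Φ ↔ ∀ (p : F) (u w : E') (N : E × E),
      (∀ t : E', sasakiModel (gramInChart I g.inner (Φ p).proj)
        (writtenInExtChartAt I' I.tangent p Φ (extChartAt I' p p))
        (fderiv ℝ (writtenInExtChartAt I' I.tangent p Φ) (extChartAt I' p p) t) N = 0) →
      secondForm (sasakiModel (gramInChart I g.inner (Φ p).proj))
        (writtenInExtChartAt I' I.tangent p Φ) (extChartAt I' p p) u w N = 0 := by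
  rw [isTotallyGeodesic_iff I.tangent I' _ hΦ]
  refine forall_congr' fun p ↦ ?_
  have h : gramInChart I.tangent (sasakiMetric I g.inner) (Φ p) =ᶠ[
      𝓝 (writtenInExtChartAt I' I.tangent p Φ (extChartAt I' p p))]
      sasakiModel (gramInChart I g.inner (Φ p).proj) := by
    rw [writtenInExtChartAt_self]
    filter_upwards [extChartAt_target_mem_nhds (I := I.tangent) (Φ p)] with y hy
    exact gramInChart_sasakiMetric I g ((mem_extChartAt_tangentBundle_target I).1 hy)
  simp only [secondForm_congr h, ← writtenInExtChartAt_self I.tangent I', h.eq_of_nhds]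

/-- A field of constant length along a submanifold is totally geodesic in the tangent bundle with
the Sasaki metric if and only if the submanifold is totally geodesic and the field is parallel. -/
theorem isTotallyGeodesic_sasakiMetric_iff_parallel (hΦ : ContMDiff I' I.tangent ∞ Φ) {C : ℝ}
    (hlen : ∀ p, √(g.inner (Φ p).proj (Φ p).snd (Φ p).snd) = C) :
    IsTotallyGeodesic I.tangent I' (sasakiMetric I g.inner) Φ ↔
      IsTotallyGeodesic I I' g.inner (fun q ↦ (Φ q).proj) ∧
        IsParallelAlong I I' g.inner (fun q ↦ (Φ q).proj) (fun q ↦ (Φ q).snd) := by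
  have hι : ContMDiff I' I ∞ fun q ↦ (Φ q).proj :=
    (Bundle.contMDiff_proj (n := ∞) (IB := I) (TangentSpace I : M → Type _)).comp hΦ
  have hbase (p : F) : (writtenInExtChartAt I' I.tangent p Φ (extChartAt I' p p)).1 =
      extChartAt I (Φ p).proj (Φ p).proj := by
    rw [writtenInExtChartAt_self, extChartAt_tangentBundle_self]
  have htgt (p : F) : (writtenInExtChartAt I' I.tangent p Φ (extChartAt I' p p)).1 ∈
      (extChartAt I (Φ p).proj).target := by
    rw [hbase]; exact mem_extChartAt_target _
  have hc (p : F) := (contDiffAt_writtenInExtChartAt I.tangent I' (hΦ p)).of_le two_le_infty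
  have hd (p : F) := (contDiffAt_gramInChart I g (htgt p)).of_le two_le_infty
  have hs (p : F) := gramInChart_symm I g.inner g.symm (x₀ := (Φ p).proj)
  have hpos (p : F) := gramInChart_pos I g.inner g.pos (htgt p)
  have hpos' (p : F) : ∀ᶠ y in 𝓝 (writtenInExtChartAt I' I.tangent p Φ (extChartAt I' p p)).1,
      ∀ v, v ≠ 0 → 0 < gramInChart I g.inner (Φ p).proj y v v := by
    filter_upwards [(isOpen_extChartAt_target (I := I) (Φ p).proj).mem_nhds (htgt p)] with y hy
    exact gramInChart_pos I g.inner g.pos hy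
  have hlen' := eventually_length_eq I I' g hΦ hlen
  have hM := isTotallyGeodesic_iff I I' g.inner hι
  -- With horizontal velocities the Sasaki product with `N` sees only its base component, so
  -- normality upstairs and downstairs agree.
  have hfst (p : F) (N : E × E) (hpar : ∀ᶠ y in 𝓝 (extChartAt I' p p), ∀ w,
      connectionModel (gramInChart I g.inner (Φ p).proj) (writtenInExtChartAt I' I.tangent p Φ y)
        (fderiv ℝ (writtenInExtChartAt I' I.tangent p Φ) y w) = 0) (t : E') :
      sasakiModel (gramInChart I g.inner (Φ p).proj)
        (writtenInExtChartAt I' I.tangent p Φ (extChartAt I' p p))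
        (fderiv ℝ (writtenInExtChartAt I' I.tangent p Φ) (extChartAt I' p p) t) N =
      gramInChart I g.inner (Φ p).proj (extChartAt I (Φ p).proj (Φ p).proj)
        (fderiv ℝ (writtenInExtChartAt I' I p fun q ↦ (Φ q).proj) (extChartAt I' p p) t) N.1 := by
    rw [sasakiModel_apply, hpar.self_of_nhds t, fderiv_fst_writtenInExtChartAt I I' hΦ, hbase]
    simp
  rw [isTotallyGeodesic_sasakiMetric_iff I I' g hΦ, hM]
  constructor
  · intro h
    have hpar : IsParallelAlong I I' g.inner (fun q ↦ (Φ q).proj) (fun q ↦ (Φ q).snd) := by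
      intro p u
      refine (covDerivAlong_eq_connectionModel I I' g hΦ p u).trans ?_
      by_contra hne
      have h1 := hpos p _ hne
      -- Total geodesy makes the left side zero, contradicting `h1`, once the vertical lift of the
      -- field is known to be normal; that is the goal left by `rw`.
      have h2 := secondForm_sasakiModel_vertical (hc p) (hd p) (hs p) (hpos' p) (hlen' p) u
      rw [h p u u _ fun t ↦ ?_] at h2
      · linarith
      · have h3 := metric_connectionModel_eq_zero ((hc p).differentiableAt (by simp))
          ((hd p).differentiableAt (by simp)) (hs p) (hpos p) (hlen' p) t
        rw [sasakiModel_apply]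
        simp only [connectionModel_apply, map_zero, add_zero, zero_add] at h3 ⊢
        exact h3
    refine ⟨fun p u w ν hν ↦ ?_, hpar⟩
    have hev := eventually_connectionModel_eq_zero I I' g hΦ hpar p
    set z := writtenInExtChartAt I' I.tangent p Φ (extChartAt I' p p)
    -- The horizontal lift of `ν`. Only its base component enters what follows.
    have h1 := h p u w (ν, -christoffelMap (gramInChart I g.inner (Φ p).proj) z.1 z.2 ν)
      fun t ↦ by rw [hfst p _ hev]; exact hν t
    rw [secondForm_sasakiModel_of_parallel (hc p) (hd p) (hpos p) hev] at h1
    exact h1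
  · rintro ⟨h, hpar⟩ p u w N hN
    have hev := eventually_connectionModel_eq_zero I I' g hΦ hpar p
    rw [secondForm_sasakiModel_of_parallel (hc p) (hd p) (hpos p) hev]
    exact h p u w N.1 fun t ↦ by rw [← hfst p N hev]; exact hN t

end Main

end

theorem theorem1 (n l : ℕ)
    (M : Type*) [TopologicalSpace M] [ChartedSpace (EuclideanSpace ℝ (Fin n)) M]
    [IsManifold (𝓡 n) ∞ M]
    (g : Bundle.ContMDiffRiemannianMetric (𝓡 n) ∞ (EuclideanSpace ℝ (Fin n))
      (fun x : M ↦ TangentSpace (𝓡 n) x))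
    (F : Type*) [TopologicalSpace F] [ChartedSpace (EuclideanSpace ℝ (Fin l)) F]
    [IsManifold (𝓡 l) ∞ F]
    (ι : F → M) (hι : ContMDiff (𝓡 l) (𝓡 n) ∞ ι)
    (hι_imm : ∀ p : F, Function.Injective (mfderiv (𝓡 l) (𝓡 n) ι p))
    (ξ : ∀ p : F, TangentSpace (𝓡 n) (ι p))
    (hξ : ContMDiff (𝓡 l) (𝓡 n).tangent ∞ (fun p ↦ (⟨ι p, ξ p⟩ : TangentBundle (𝓡 n) M)))
    (hlen : ∃ c : ℝ, ∀ p : F, √(g.inner (ι p) (ξ p) (ξ p)) = c) :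
    IsTotallyGeodesic (𝓡 n).tangent (𝓡 l) (sasakiMetric (𝓡 n) g.inner)
        (fun p ↦ (⟨ι p, ξ p⟩ : TangentBundle (𝓡 n) M)) ↔
      IsTotallyGeodesic (𝓡 n) (𝓡 l) g.inner ι ∧
        IsParallelAlong (𝓡 n) (𝓡 l) g.inner ι ξ := by
  obtain ⟨C, hC⟩ := hlen
  exact isTotallyGeodesic_sasakiMetric_iff_parallel (𝓡 n) (𝓡 l) g hξ hC
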